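/- Let $A_a,B_a$ ($a=1,\dots,n$) be the annihilation operators of $2n$ decoupled harmonic oscillators, $[A_a,A_b^\dagger]=[B_a,B_b^\dagger]=\delta_{ab}$ (all other commutators zero), acting on the Hilbert space with orthonormal occupation-number basis and vacuum $|0\rangle$. Put $$E_{ab}=A_a^\dagger A_b+B_a^\dagger B_b+\delta_{ab},\qquad \mathcal A_{ab}=\tfrac12(E_{ab}-\delta_{ab}),\qquad \mathcal A_a=\mathcal A_{aa},\qquad \mathcal A=\sum_a\mathcal A_a,$$ $$\widetilde F_{ab}=B_a^\dagger A_b^\dagger-A_a^\dagger B_b^\dagger,\qquad \widetilde F_\zeta=\sum_{a,b}\zeta_{ab}\widetilde F_{ab}.$$ For $\zeta\in\Omega_n=\{\zeta\in M_n(\mathbb C):\zeta^T=-\zeta,\ \zeta^*\zeta<1\}$ let $$|\zeta\rangle=\det(1-\zeta^*\zeta)^{1/2}\exp(\tfrac12\widetilde F_\zeta)|0\rangle=\det(1-\zeta^*\zeta)^{1/2}\sum_{k\ge0}\tfrac1{k!}(\tfrac12\widetilde F_\zeta)^k|0\rangle .$$ Write $\langle X\rangle=\langle\zeta|X|\zeta\rangle$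 and $\mathrm{Var}(X)=\langle X^2\rangle-\langle X\rangle^2$. (1) For every $\zeta\in\Omega_n$ the series converges, $|\zeta\rangle$ is a unit vector, it lies in the (maximal) domains of the operators $\mathcal A_{ab}$, $\mathcal A_a\mathcal A_b$, $\mathcal A$, $\mathcal A^2$, and $$\langle\mathcal A_a\rangle=\big[\zeta^*\zeta(1-\zeta^*\zeta)^{-1}\big]_{aa},\qquad \langle\mathcal A\rangle=\mathrm{tr}\big[\zeta^*\zeta(1-\zeta^*\zeta)^{-1}\big],$$ $$\mathrm{Var}(\mathcal A_a)=\tfrac12\langle\mathcal A_a\rangle\big(\langle\mathcal A_a\rangle+1\big),\qquad \mathrm{Var}(\mathcal A)=\sum_{a,b}\langle\mathcal A_{ab}\rangle\big(\langle\mathcal A_{ba}\rangle+\delta_{ab}\big).$$ (2) There is $c\in(0,1]$, depending only on $n$, such that the following holds for every family (in particular every sequence) of non-zero $\zeta\in\Omega_n$ along which all the non-zero eigenvalues of $\zeta^*\zeta$ tend to $1$. The variance $\mathrm{Var}(\mathcal A)$ tends to $+\infty$, while the coefficient of variation $\sqrt{\mathrm{Var}(\mathcal A)}/\langle\mathcal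 A\rangle$ approaches the interval $[c,1]$ (it is eventually in every neighbourhood of it); hence it has limit points, and every limit point lies in $(0,1]$. If moreover the relative rates of approach converge, that is, if with $\lambda_1\ge\dots\ge\lambda_n$ the eigenvalues of $\zeta^*\zeta$ the ratio $(1-\lambda_1)/(1-\lambda_j)$ converges for every $j$, then the coefficient of variation converges to a value in $(0,1]$. -/

import Mathlib

open Filter Topology
open scoped Matrix ComplexOrder

noncomputable section

namespace CoherentIntertwiner

/-- The `2n` oscillator modes: `Sum.inl a` is the mode of `A_a`, `Sum.inr a` that of `B_a`. -/
abbrev Mode (n : ℕ) : Type := Fin n ⊕ Fin n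

/-- Occupation numbers of the `2n` oscillators; they label the orthonormal basis `|μ,ν⟩`. -/
abbrev Occ (n : ℕ) : Type := Mode n → ℕ

/-- Formal (not necessarily normalisable) vectors `∑ ψ(x) |x⟩`, given by their coefficients. -/
abbrev Formal (n : ℕ) : Type := Occ n → ℂ

/-- The Hilbert space of the `2n` oscillators: square-summable coefficients. -/
abbrev Fock (n : ℕ) : Type := lp (fun _ : Occ n => ℂ) 2

variable {n : ℕ}

/-- Lowering operator of the mode `m`: `|x⟩ ↦ √(x m) |x - e_m⟩`. In coefficients,
the coefficient of `|x⟩` in the image of `ψ` is `√(x m + 1) ψ (x + e_m)`. -/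
def lower (m : Mode n) : Module.End ℂ (Formal n) where
  toFun ψ x := (Real.sqrt ((x m : ℝ) + 1) : ℂ) * ψ (Function.update x m (x m + 1))
  map_add' ψ φ := by funext x; simp [mul_add]
  map_smul' c ψ := by funext x; simp [mul_left_comm]

/-- Raising operator of the mode `m`: `|x⟩ ↦ √(x m + 1) |x + e_m⟩`. In coefficients,
the coefficient of `|x⟩` in the image of `ψ` is `√(x m) ψ (x - e_m)`, which is `0` when
`x m = 0`. -/
def raise (m : Mode n) : Module.End ℂ (Formal n) where
  toFun ψ x := (Real.sqrt (x m : ℝ) : ℂ) * ψ (Function.update x m (x m - 1))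
  map_add' ψ φ := by funext x; simp [mul_add]
  map_smul' c ψ := by funext x; simp [mul_left_comm]

/-- `A_a`, `A_a†`, `B_a`, `B_a†`. -/
def opA (a : Fin n) : Module.End ℂ (Formal n) := lower (Sum.inl a)
def opAdag (a : Fin n) : Module.End ℂ (Formal n) := raise (Sum.inl a)
def opB (a : Fin n) : Module.End ℂ (Formal n) := lower (Sum.inr a)
def opBdag (a : Fin n) : Module.End ℂ (Formal n) := raise (Sum.inr a)

/-- `E_ab = A_a† A_b + B_a† B_b + δ_ab`. -/
def opE (a b : Fin n) : Module.End ℂ (Formal n) :=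
  opAdag a * opA b + opBdag a * opB b + (if a = b then 1 else 0)

/-- `F̃_ab = B_a† A_b† - A_a† B_b†`. -/
def opFt (a b : Fin n) : Module.End ℂ (Formal n) :=
  opBdag a * opAdag b - opAdag a * opBdag b

/-- `F̃_z = ∑_ab z_ab F̃_ab`. -/
def opFtOf (z : Matrix (Fin n) (Fin n) ℂ) : Module.End ℂ (Formal n) :=
  ∑ a, ∑ b, z a b • opFt a b

/-- `𝒜_ab = ½ (E_ab - δ_ab)`. -/
def areaAB (a b : Fin n) : Module.End ℂ (Formal n) :=
  (1 / 2 : ℂ) • (opE a b - (if a = b then 1 else 0))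

/-- The area operator `𝒜_a = 𝒜_aa` of the leg `a`. -/
def area (a : Fin n) : Module.End ℂ (Formal n) := areaAB a a

/-- The total area operator `𝒜 = ∑_a 𝒜_a`. -/
def totalArea : Module.End ℂ (Formal n) := ∑ a, area a

/-- The operator in the Hilbert space given by a formal expression `T` in the oscillators, on its
maximal domain: all `ψ` in the Hilbert space for which `T ψ` lies in the Hilbert space. -/
def hilbertOp (T : Module.End ℂ (Formal n)) : Fock n →ₗ.[ℂ] Fock n where
  domain :=
    { carrier := {ψ | Memℓp (T (ψ : Formal n)) 2}
      zero_mem' := by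
        simp only [Set.mem_ofPred_eq, lp.coeFn_zero, map_zero]
        exact zero_memℓp
      add_mem' := by
        intro ψ φ hψ hφ
        simp only [Set.mem_ofPred_eq, lp.coeFn_add, map_add] at *
        exact hψ.add hφ
      smul_mem' := by
        intro c ψ hψ
        simp only [Set.mem_ofPred_eq, lp.coeFn_smul, map_smul] at *
        exact hψ.const_smul c }
  toFun :=
    { toFun := fun ψ => ⟨T ((ψ : Fock n) : Formal n), ψ.2⟩
      map_add' := by
        intro ψ φ
        apply lp.ext
        exact map_add T _ _
      map_smul' := by
        intro c ψ
        apply lp.ext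
        simp }

open Classical in
/-- `⟨ψ|T|ψ⟩`, for `ψ` in the domain of `T`. -/
def expect (T : Module.End ℂ (Formal n)) (ψ : Fock n) : ℂ :=
  if h : ψ ∈ (hilbertOp T).domain then inner ℂ ψ (hilbertOp T ⟨ψ, h⟩) else 0

/-- `Cov(S, T) = ⟨ST⟩ - ⟨S⟩⟨T⟩`. -/
def cov (S T : Module.End ℂ (Formal n)) (ψ : Fock n) : ℂ :=
  expect (S * T) ψ - expect S ψ * expect T ψ

/-- `Var(T) = Cov(T, T)`. -/
def var (T : Module.End ℂ (Formal n)) (ψ : Fock n) : ℂ := cov T T ψ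

/-- The coefficient of variation `√Var(T) / ⟨T⟩`. -/
def coeffVar (T : Module.End ℂ (Formal n)) (ψ : Fock n) : ℝ :=
  Real.sqrt (var T ψ).re / (expect T ψ).re

/-- The bounded symmetric domain `Ω_n`: antisymmetric `ζ` with `ζ* ζ < 1`. -/
def Omega (n : ℕ) : Set (Matrix (Fin n) (Fin n) ℂ) :=
  {ζ | ζᵀ = -ζ ∧ (1 - ζᴴ * ζ).PosDef}

/-- The vacuum `|0⟩`. -/
def vac : Formal n := Pi.single 0 1

/-! Vectors with finitely many non-zero coefficients (`Memℓp _ 0`) are preserved by raising. -/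

theorem raise_finite (m : Mode n) {ψ : Formal n} (h : Memℓp ψ 0) : Memℓp (raise m ψ) 0 := by
  rw [memℓp_zero_iff] at *
  refine (h.image fun x => Function.update x m (x m + 1)).subset ?_
  intro x hx
  have hx' : (Real.sqrt (x m : ℝ) : ℂ) * ψ (Function.update x m (x m - 1)) ≠ 0 := hx
  have h1 : x m ≠ 0 := by
    intro h0
    apply hx'
    simp [h0]
  refine ⟨Function.update x m (x m - 1), right_ne_zero_of_mul hx', ?_⟩
  have h2 : x m - 1 + 1 = x m := by omega
  simp [h2]

theorem opFtOf_finite (z : Matrix (Fin n) (Fin n) ℂ) {ψ : Formal n} (h : Memℓp ψ 0) :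
    Memℓp (opFtOf z ψ) 0 := by
  have h1 : ∀ a b, Memℓp ((z a b • opFt a b) ψ) 0 := by
    intro a b
    have := ((raise_finite (Sum.inr a) (raise_finite (Sum.inl b) h)).sub
      (raise_finite (Sum.inl a) (raise_finite (Sum.inr b) h))).const_smul (z a b)
    exact this
  have h2 : opFtOf z ψ = ∑ a, ∑ b, (z a b • opFt a b) ψ := by
    simp [opFtOf, LinearMap.sum_apply]
  have h3 : ∀ a, Memℓp (∑ b, (z a b • opFt a b) ψ) 0 := by
    intro a
    have := Memℓp.finsetSum (p := 0) Finset.univ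
      (f := fun b => (z a b • opFt a b) ψ) (fun b _ => h1 a b)
    convert this using 1
    funext x
    simp
  rw [h2]
  have := Memℓp.finsetSum (p := 0) Finset.univ
      (f := fun a => ∑ b, (z a b • opFt a b) ψ) (fun a _ => h3 a)
  convert this using 1
  funext x
  simp

theorem powVec_memℓp (ζ : Matrix (Fin n) (Fin n) ℂ) (k : ℕ) :
    Memℓp ((((1 / 2 : ℂ) • opFtOf ζ) ^ k) vac) 2 := by
  have h : Memℓp ((((1 / 2 : ℂ) • opFtOf ζ) ^ k) vac) 0 := by
    induction k with
    | zero =>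
      rw [memℓp_zero_iff]
      refine (Set.finite_singleton (0 : Occ n)).subset ?_
      intro x hx
      by_contra hne
      apply hx
      have hne' : x ≠ 0 := hne
      simp [vac, Pi.single_apply, hne']
    | succ k ih =>
      rw [pow_succ']
      exact (opFtOf_finite ζ ih).const_smul (1 / 2 : ℂ)
  exact h.of_exponent_ge (by simp)

/-- `(½ F̃_ζ)^k |0⟩` as a vector of the Hilbert space. -/
def powVec (ζ : Matrix (Fin n) (Fin n) ℂ) (k : ℕ) : Fock n :=
  ⟨(((1 / 2 : ℂ) • opFtOf ζ) ^ k) vac, powVec_memℓp ζ k⟩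

/-- The terms `(½ F̃_ζ)^k |0⟩ / k!` of the series of `exp(½ F̃_ζ) |0⟩`. -/
def expTerm (ζ : Matrix (Fin n) (Fin n) ℂ) (k : ℕ) : Fock n :=
  ((k.factorial : ℂ)⁻¹) • powVec ζ k

/-- The coherent state `|ζ⟩ = det(1 - ζ* ζ)^{1/2} exp(½ F̃_ζ) |0⟩`. For `ζ ∈ Ω_n` the determinant
is a positive real number. -/
def coherent (ζ : Matrix (Fin n) (Fin n) ℂ) : Fock n :=
  (Real.sqrt (1 - ζᴴ * ζ).det.re : ℂ) • ∑' k, expTerm ζ k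

/-- The eigenvalues of `ζ* ζ`, repeated according to multiplicity. -/
def eig (ζ : Matrix (Fin n) (Fin n) ℂ) : Fin n → ℝ :=
  (Matrix.isHermitian_conjTranspose_mul_self ζ).eigenvalues

/-- Along the filter `l`, all the non-zero eigenvalues of `(Z i)* (Z i)` tend to `1`. -/
def NonzeroEigTendToOne {ι : Type*} (l : Filter ι) (Z : ι → Matrix (Fin n) (Fin n) ℂ) : Prop :=
  ∀ ε : ℝ, 0 < ε → ∀ᶠ i in l, ∀ j, eig (Z i) j ≠ 0 → |eig (Z i) j - 1| < ε

end CoherentIntertwiner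

end

/-! The whole computation rests on one property of the coherent state: lowering a quantum of one
family equals raising quanta of the other, `A_b|ζ⟩ = ∑_d ζ_db B_d†|ζ⟩` and `B_d|ζ⟩ = ∑_b ζ_db
A_b†|ζ⟩` (`Paired`, `expVec_paired`). Moving operators across the inner product and commuting them
turns each moment into a linear equation for a Gram matrix. First moments satisfy `G = (G + 1) ζ*ζ`,
so `G = ζ*ζ (1 - ζ*ζ)⁻¹`. Second moments satisfy similar equations, whose solutions are the Wick
contractions (`Paired.weightedGram_same`, `Paired.weightedGram_other`).

The same argument, graded by the order `k` of the exponential series, gives convergence and the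
norm. The Gram recursion and the fact that order `k` carries `k` quanta in each family yield
Newton's identities for the squared norms. These are therefore the complete homogeneous symmetric
polynomials of the eigenvalues `λ_j` of `ζ*ζ`, and they sum to `∏ (1 - λ_j)⁻¹ = det(1 - ζ*ζ)⁻¹`. All
manipulations take place in `rapid`, a space stable under the ladder operators, so no domain
question arises.

With `x_j = λ_j / (1 - λ_j)` the total area has mean `∑ x_j` and variance `∑ x_j (x_j + 1)`.
Cauchy–Schwarz bounds the coefficient of variation below; `∑ x_j² ≤ (∑ x_j)²`, with `λ_j` near 1
whenever non-zero, bounds it above. Rescaling by `1 - λ_1` gives the convergence statement. -/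

noncomputable section

namespace CoherentIntertwiner

variable {n : ℕ}

/-! ### Ladder operators and their commutation relations -/

theorem lower_apply (m : Mode n) (ψ : Formal n) (x : Occ n) :
    lower m ψ x = (Real.sqrt ((x m : ℝ) + 1) : ℂ) * ψ (Function.update x m (x m + 1)) := rfl

theorem raise_apply (m : Mode n) (ψ : Formal n) (x : Occ n) :
    raise m ψ x = (Real.sqrt (x m : ℝ) : ℂ) * ψ (Function.update x m (x m - 1)) := rfl

theorem raise_lower_apply (m : Mode n) (ψ : Formal n) (x : Occ n) :
    raise m (lower m ψ) x = (x m : ℂ) * ψ x := by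
  rw [raise_apply, lower_apply]
  rcases Nat.eq_zero_or_pos (x m) with h | h
  · simp [h]
  · have h1 : x m - 1 + 1 = x m := by omega
    have h2 : (((x m - 1 : ℕ) : ℝ) + 1) = x m := by exact_mod_cast h1
    simp only [Function.update_self, Function.update_idem, h1, Function.update_eq_self, h2]
    rw [← mul_assoc, ← Complex.ofReal_mul, Real.mul_self_sqrt (Nat.cast_nonneg _)]
    simp

theorem lower_raise_self_apply (m : Mode n) (ψ : Formal n) (x : Occ n) :
    lower m (raise m ψ) x = ((x m : ℂ) + 1) * ψ x := by
  rw [lower_apply, raise_apply]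
  simp only [Function.update_self, Function.update_idem, Nat.add_sub_cancel,
    Function.update_eq_self, Nat.cast_add, Nat.cast_one]
  rw [← mul_assoc, ← Complex.ofReal_mul, Real.mul_self_sqrt (by positivity)]
  simp

/-- The canonical commutation relation of lowering and raising operators. -/
theorem lower_raise (m m' : Mode n) (ψ : Formal n) :
    lower m (raise m' ψ) = raise m' (lower m ψ) + if m = m' then ψ else 0 := by
  funext x
  by_cases h : m = m'
  · subst h
    simp only [if_true, Pi.add_apply, lower_raise_self_apply, raise_lower_apply]
    ring
  · have h' : m' ≠ m := fun e => h e.symm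
    simp only [if_neg h, add_zero, lower_apply, raise_apply, Function.update_of_ne h,
      Function.update_of_ne h']
    rw [Function.update_comm h]
    ring

theorem lower_comm (m m' : Mode n) (ψ : Formal n) :
    lower m (lower m' ψ) = lower m' (lower m ψ) := by
  by_cases h : m = m'
  · rw [h]
  · funext x
    have h' : m' ≠ m := fun e => h e.symm
    simp only [lower_apply, Function.update_of_ne h, Function.update_of_ne h']
    rw [Function.update_comm h]
    ring

theorem raise_comm (m m' : Mode n) (ψ : Formal n) :
    raise m (raise m' ψ) = raise m' (raise m ψ) := by
  by_cases h : m = m'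
  · rw [h]
  · funext x
    have h' : m' ≠ m := fun e => h e.symm
    simp only [raise_apply, Function.update_of_ne h, Function.update_of_ne h']
    rw [Function.update_comm h]
    ring

theorem continuous_lower (m : Mode n) : Continuous (lower m : Formal n → Formal n) :=
  continuous_pi fun _ => continuous_const.mul (continuous_apply _)

theorem continuous_raise (m : Mode n) : Continuous (raise m : Formal n → Formal n) :=
  continuous_pi fun _ => continuous_const.mul (continuous_apply _)

/-! ### Rapidly decreasing vectors -/

/-- The total occupation number. -/
def occ (x : Occ n) : ℕ := ∑ i, x i

/-- The occupation numbers with one more quantum in the mode `m`. -/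
def incr (m : Mode n) (x : Occ n) : Occ n := Function.update x m (x m + 1)

theorem incr_injective (m : Mode n) : Function.Injective (incr m : Occ n → Occ n) := by
  intro x y h
  funext i
  have := congrFun h i
  by_cases hi : i = m
  · subst hi
    simpa [incr] using this
  · simpa [incr, hi] using this

theorem incr_sub_one (m : Mode n) {x : Occ n} (h : x m ≠ 0) :
    incr m (Function.update x m (x m - 1)) = x := by
  have h1 : x m - 1 + 1 = x m := by omega
  simp [incr, h1]

theorem mem_range_incr (m : Mode n) {x : Occ n} (h : x m ≠ 0) :
    x ∈ Set.range (incr m : Occ n → Occ n) := ⟨_, incr_sub_one m h⟩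

theorem occ_incr (m : Mode n) (x : Occ n) : occ (incr m x) = occ x + 1 := by
  simp only [occ, incr]
  rw [← Finset.add_sum_erase _ _ (Finset.mem_univ m),
    ← Finset.add_sum_erase _ x (Finset.mem_univ m), Function.update_self,
    Finset.sum_congr rfl fun i hi => Function.update_of_ne (Finset.ne_of_mem_erase hi) _ _]
  ring

theorem le_occ (m : Mode n) (x : Occ n) : x m ≤ occ x :=
  Finset.single_le_sum (f := x) (fun _ _ => Nat.zero_le _) (Finset.mem_univ m)

theorem raise_incr (m : Mode n) (ψ : Formal n) (x : Occ n) :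
    raise m ψ (incr m x) = (Real.sqrt ((x m : ℝ) + 1) : ℂ) * ψ x := by
  rw [raise_apply]
  simp [incr]

theorem norm_sqrt_mul_sq {a : ℝ} (ha : 0 ≤ a) (z : ℂ) :
    ‖(Real.sqrt a : ℂ) * z‖ ^ 2 = a * ‖z‖ ^ 2 := by
  rw [norm_mul, mul_pow, Complex.norm_real, Real.norm_eq_abs, sq_abs, Real.sq_sqrt ha]

/-- Rapidly decreasing vectors: all polynomially weighted sums of squares converge. -/
def rapid (n : ℕ) : Submodule ℂ (Formal n) where
  carrier := {ψ | ∀ p : ℕ, Summable fun x => ((occ x : ℝ) + 1) ^ p * ‖ψ x‖ ^ 2}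
  zero_mem' p := by simp
  add_mem' {ψ φ} hψ hφ p := by
    refine Summable.of_nonneg_of_le (fun x => by positivity) (fun x => ?_)
      (((hψ p).add (hφ p)).mul_left 2)
    have h1 : ‖(ψ + φ) x‖ ^ 2 ≤ 2 * (‖ψ x‖ ^ 2 + ‖φ x‖ ^ 2) := by
      have := norm_add_le (ψ x) (φ x)
      have h0 := norm_nonneg (ψ x + φ x)
      calc ‖(ψ + φ) x‖ ^ 2 ≤ (‖ψ x‖ + ‖φ x‖) ^ 2 := by
            apply pow_le_pow_left₀ h0 this
        _ ≤ _ := by nlinarith [sq_nonneg (‖ψ x‖ - ‖φ x‖)]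
    calc _ ≤ ((occ x : ℝ) + 1) ^ p * (2 * (‖ψ x‖ ^ 2 + ‖φ x‖ ^ 2)) := by gcongr
      _ = _ := by ring
  smul_mem' c ψ hψ p := by
    refine ((hψ p).mul_left (‖c‖ ^ 2)).congr fun x => ?_
    simp [mul_pow]
    ring

theorem lower_mem_rapid (m : Mode n) {ψ : Formal n} (h : ψ ∈ rapid n) : lower m ψ ∈ rapid n := by
  intro p
  refine Summable.of_nonneg_of_le (fun x => by positivity) (fun x => ?_)
    ((h (p + 1)).comp_injective (incr_injective m))
  have h1 : (x m : ℝ) ≤ occ x := by exact_mod_cast le_occ m x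
  rw [lower_apply, norm_sqrt_mul_sq (a := (x m : ℝ) + 1) (by positivity),
    Function.comp_apply, occ_incr]
  change _ ≤ _ * ‖ψ (Function.update x m (x m + 1))‖ ^ 2
  rw [← mul_assoc]
  refine mul_le_mul_of_nonneg_right ?_ (by positivity)
  rw [pow_succ]
  push_cast
  gcongr <;> linarith

theorem raise_mem_rapid (m : Mode n) {ψ : Formal n} (h : ψ ∈ rapid n) : raise m ψ ∈ rapid n := by
  intro p
  rw [← (incr_injective m).summable_iff]
  · refine Summable.of_nonneg_of_le (fun x => mul_nonneg (by positivity) (sq_nonneg _))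
      (fun x => ?_)
      ((h (p + 1)).mul_left (2 ^ p))
    have h1 : (x m : ℝ) ≤ occ x := by exact_mod_cast le_occ m x
    rw [Function.comp_apply, raise_incr, norm_sqrt_mul_sq (a := (x m : ℝ) + 1) (by positivity),
      occ_incr, ← mul_assoc,
      ← mul_assoc]
    refine mul_le_mul_of_nonneg_right ?_ (by positivity)
    rw [pow_succ, ← mul_assoc, ← mul_pow]
    push_cast
    gcongr
    linarith [(occ x).cast_nonneg (α := ℝ)]
  · intro x hx
    have : x m = 0 := by
      by_contra h0
      exact hx (mem_range_incr m h0)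
    simp [raise_apply, this]

theorem memℓp_of_mem_rapid {ψ : Formal n} (h : ψ ∈ rapid n) : Memℓp ψ 2 := by
  refine memℓp_gen ?_
  simpa using h 0

theorem mem_rapid_of_finite {ψ : Formal n} (h : Memℓp ψ 0) : ψ ∈ rapid n := by
  intro p
  refine summable_of_hasFiniteSupport ((memℓp_zero_iff.1 h).subset fun x hx => ?_)
  intro h0
  apply hx
  simp [h0]

/-! ### Inner product and adjoints -/

/-- The inner product of formal vectors, given by the sum of the products of coefficients. -/
def ip (φ ψ : Formal n) : ℂ := ∑' x, starRingEnd ℂ (φ x) * ψ x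

theorem summable_ip {φ ψ : Formal n} (hφ : φ ∈ rapid n) (hψ : ψ ∈ rapid n) :
    Summable fun x => starRingEnd ℂ (φ x) * ψ x := by
  have := lp.summable_inner (𝕜 := ℂ) (⟨φ, memℓp_of_mem_rapid hφ⟩ : Fock n)
    (⟨ψ, memℓp_of_mem_rapid hψ⟩ : Fock n)
  refine this.congr fun x => ?_
  rw [RCLike.inner_apply]
  ring

theorem inner_eq_ip (φ ψ : Fock n) : inner ℂ φ ψ = ip (φ : Formal n) ψ := by
  rw [lp.inner_eq_tsum, ip]
  refine tsum_congr fun x => ?_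
  rw [RCLike.inner_apply]
  ring

theorem ip_add_right {φ ψ χ : Formal n} (hφ : φ ∈ rapid n) (hψ : ψ ∈ rapid n) (hχ : χ ∈ rapid n) :
    ip φ (ψ + χ) = ip φ ψ + ip φ χ := by
  rw [ip, ip, ip, ← (summable_ip hφ hψ).tsum_add (summable_ip hφ hχ)]
  exact tsum_congr fun x => mul_add _ _ _

theorem ip_smul_right (c : ℂ) (φ ψ : Formal n) : ip φ (c • ψ) = c * ip φ ψ := by
  rw [ip, ip, ← tsum_mul_left]
  exact tsum_congr fun x => by simp [mul_left_comm]

theorem ip_zero_right (φ : Formal n) : ip φ 0 = 0 := by simp [ip]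

theorem ip_conj (φ ψ : Formal n) : starRingEnd ℂ (ip φ ψ) = ip ψ φ := by
  rw [ip, ip, Complex.conj_tsum]
  exact tsum_congr fun x => by simp [mul_comm]

theorem ip_smul_left (c : ℂ) (φ ψ : Formal n) : ip (c • φ) ψ = starRingEnd ℂ c * ip φ ψ := by
  rw [← ip_conj, ip_smul_right, map_mul, ip_conj]

theorem ip_sum_right {ι : Type*} (s : Finset ι) {φ : Formal n} {ψ : ι → Formal n}
    (hφ : φ ∈ rapid n) (hψ : ∀ i, ψ i ∈ rapid n) : ip φ (∑ i ∈ s, ψ i) = ∑ i ∈ s, ip φ (ψ i) := by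
  classical
  induction s using Finset.induction_on with
  | empty => simp [ip_zero_right]
  | insert a s ha ih =>
    rw [Finset.sum_insert ha, Finset.sum_insert ha,
      ip_add_right hφ (hψ a) (Submodule.sum_mem _ fun i _ => hψ i), ih]

theorem ip_sum_left {ι : Type*} (s : Finset ι) {φ : Formal n} {ψ : ι → Formal n}
    (hφ : φ ∈ rapid n) (hψ : ∀ i, ψ i ∈ rapid n) : ip (∑ i ∈ s, ψ i) φ = ∑ i ∈ s, ip (ψ i) φ := by
  rw [← ip_conj, ip_sum_right s hφ hψ, map_sum]
  exact Finset.sum_congr rfl fun i _ => ip_conj _ _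

/-- Lowering and raising operators are formal adjoints of each other. -/
theorem ip_raise_right (m : Mode n) (φ ψ : Formal n) : ip φ (raise m ψ) = ip (lower m φ) ψ := by
  rw [ip, ip, ← (incr_injective m).tsum_eq]
  · refine tsum_congr fun x => ?_
    rw [raise_incr, lower_apply, map_mul, Complex.conj_ofReal]
    simp only [incr]
    ring
  · intro x hx
    by_contra h0
    have : x m = 0 := by
      by_contra h1
      exact h0 (mem_range_incr m h1)
    apply hx
    simp [raise_apply, this]

theorem ip_raise_left (m : Mode n) (φ ψ : Formal n) : ip (raise m φ) ψ = ip φ (lower m ψ) := by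
  rw [← ip_conj, ip_raise_right, ip_conj]

theorem ip_self (ψ : Formal n) : ip ψ ψ = ((∑' x, ‖ψ x‖ ^ 2 : ℝ) : ℂ) := by
  rw [ip, Complex.ofReal_tsum]
  refine tsum_congr fun x => ?_
  rw [← Complex.normSq_eq_conj_mul_self, Complex.normSq_eq_norm_sq]

theorem lower_raise_of_ne {m m' : Mode n} (h : m ≠ m') (ψ : Formal n) :
    lower m (raise m' ψ) = raise m' (lower m ψ) := by rw [lower_raise, if_neg h, add_zero]

theorem ip_zero_left (φ : Formal n) : ip 0 φ = 0 := by rw [← ip_conj, ip_zero_right, map_zero]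

theorem ip_add_left {φ ψ χ : Formal n} (hφ : φ ∈ rapid n) (hψ : ψ ∈ rapid n) (hχ : χ ∈ rapid n) :
    ip (ψ + χ) φ = ip ψ φ + ip χ φ := by
  rw [← ip_conj, ip_add_right hφ hψ hχ, map_add, ip_conj, ip_conj]

theorem ite_mem_rapid (P : Prop) [Decidable P] {ψ : Formal n} (h : ψ ∈ rapid n) :
    (if P then ψ else 0) ∈ rapid n := by
  split_ifs
  exacts [h, Submodule.zero_mem _]

/-! ### First and second moments of paired vectors -/

/-- Lowering `ψ` in a mode of one family amounts to raising `ψ'` in the modes of the other one,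
with coefficients given by `Z`. -/
def Paired (p q : Fin n → Mode n) (Z : Matrix (Fin n) (Fin n) ℂ) (ψ ψ' : Formal n) : Prop :=
  (∀ b, lower (p b) ψ = ∑ d, Z d b • raise (q d) ψ') ∧
    ∀ d, lower (q d) ψ = ∑ b, Z d b • raise (p b) ψ'

/-- The Gram matrix of the vectors obtained by lowering `ψ` in the modes `p`. -/
def gram (p : Fin n → Mode n) (ψ : Formal n) : Matrix (Fin n) (Fin n) ℂ :=
  Matrix.of fun a b => ip (lower (p a) ψ) (lower (p b) ψ)

/-- The Gram matrix of the vectors obtained by lowering `ψ` in the modes `p`, weighted with the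
occupation number of the mode `m`. -/
def weightedGram (p : Fin n → Mode n) (m : Mode n) (ψ : Formal n) : Matrix (Fin n) (Fin n) ℂ :=
  Matrix.of fun a b => ip (lower m (lower (p a) ψ)) (lower m (lower (p b) ψ))

section

variable {p q : Fin n → Mode n} {Z : Matrix (Fin n) (Fin n) ℂ} {ψ ψ' : Formal n}

theorem Paired.swap (h : Paired p q Z ψ ψ') : Paired q p Zᵀ ψ ψ' := ⟨h.2, h.1⟩

theorem Paired.smul (h : Paired p q Z ψ ψ') (c : ℂ) : Paired p q Z (c • ψ) (c • ψ') := by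
  constructor
  · intro b
    simp only [map_smul, h.1, Finset.smul_sum]
    exact Finset.sum_congr rfl fun d _ => smul_comm _ _ _
  · intro b
    simp only [map_smul, h.2, Finset.smul_sum]
    exact Finset.sum_congr rfl fun d _ => smul_comm _ _ _

theorem Paired.ip_lower (h : Paired p q Z ψ ψ') (hψ' : ψ' ∈ rapid n) {φ : Formal n}
    (hφ : φ ∈ rapid n) (b : Fin n) :
    ip φ (lower (p b) ψ) = ∑ d, Z d b * ip (lower (q d) φ) ψ' := by
  rw [h.1, ip_sum_right _ hφ fun d => Submodule.smul_mem _ _ (raise_mem_rapid _ hψ')]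
  exact Finset.sum_congr rfl fun d _ => by rw [ip_smul_right, ip_raise_right]

/-- Lowering in the second family expands in lowered vectors of the first family. -/
theorem Paired.lower_lower (h : Paired p q Z ψ ψ') (hp : Function.Injective p) (a d : Fin n) :
    lower (q d) (lower (p a) ψ) =
      ∑ e, Z d e • (raise (p e) (lower (p a) ψ') + if a = e then ψ' else 0) := by
  rw [lower_comm, h.2, map_sum]
  refine Finset.sum_congr rfl fun e _ => ?_
  rw [map_smul, lower_raise]
  simp only [hp.eq_iff]

/-- In the moment equations `Z` comes out of the right slot of `ip` and its conjugate out of the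
left one; this combines them into `Zᴴ * Z`. -/
theorem sum_mul_sum_conj (Z : Matrix (Fin n) (Fin n) ℂ) (b : Fin n) (g : Fin n → ℂ) :
    ∑ d, Z d b * ∑ e, starRingEnd ℂ (Z d e) * g e = ∑ e, g e * (Zᴴ * Z) e b := by
  simp only [Matrix.mul_apply, Matrix.conjTranspose_apply, Finset.mul_sum]
  rw [Finset.sum_comm]
  refine Finset.sum_congr rfl fun e _ => Finset.sum_congr rfl fun d _ => ?_
  rw [starRingEnd_apply]
  ring

/-- Recursion for the Gram matrix. -/
theorem Paired.gram_eq (h : Paired p q Z ψ ψ') (hp : Function.Injective p) (hψ : ψ ∈ rapid n)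
    (hψ' : ψ' ∈ rapid n) :
    gram p ψ = (gram p ψ' + ip ψ' ψ' • 1) * (Zᴴ * Z) := by
  ext a b
  rw [gram, Matrix.of_apply, h.ip_lower hψ' (lower_mem_rapid _ hψ), Matrix.mul_apply,
    ← sum_mul_sum_conj]
  refine Finset.sum_congr rfl fun d _ => ?_
  have hr : ∀ e, raise (p e) (lower (p a) ψ') ∈ rapid n := fun e =>
    raise_mem_rapid _ (lower_mem_rapid _ hψ')
  rw [h.lower_lower hp, ip_sum_left _ hψ' fun e => Submodule.smul_mem _ _
    (Submodule.add_mem _ (hr e) (ite_mem_rapid _ hψ'))]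
  congr 1
  refine Finset.sum_congr rfl fun e _ => ?_
  rw [ip_smul_left, ip_add_left hψ' (hr e) (ite_mem_rapid _ hψ'), ip_raise_left]
  by_cases hae : a = e
  · simp [hae, gram]
  · simp [hae, gram, ip_zero_left]

/-- Recursion for the Gram matrix weighted with the occupation number of a mode of the same
family. -/
theorem Paired.weightedGram_eq (h : Paired p q Z ψ ψ) (hp : Function.Injective p)
    (hpq : ∀ a b, p a ≠ q b) (hψ : ψ ∈ rapid n) (c : Fin n) :
    weightedGram p (p c) ψ =
      (weightedGram p (p c) ψ + gram p ψ c c • 1 +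
        Matrix.of fun a e => if e = c then gram p ψ a c else 0) * (Zᴴ * Z) := by
  ext a b
  have hψa := lower_mem_rapid (p a) hψ
  have hY : ∀ {φ : Formal n}, φ ∈ rapid n → raise (p c) (lower (p c) φ) ∈ rapid n := fun hφ =>
    raise_mem_rapid _ (lower_mem_rapid _ hφ)
  have e1 : weightedGram p (p c) ψ a b =
      ip (raise (p c) (lower (p c) (lower (p a) ψ))) (lower (p b) ψ) := by
    rw [ip_raise_left]; rfl
  rw [e1, h.ip_lower hψ (hY hψa), Matrix.mul_apply, ← sum_mul_sum_conj]
  refine Finset.sum_congr rfl fun d _ => ?_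
  -- `lower (q d)` commutes with the number operator of `p c`, so it reaches `lower (p a) ψ` and can
  -- be expanded by pairing.
  rw [lower_raise_of_ne (hpq c d).symm, lower_comm (q d), h.lower_lower hp, map_sum, map_sum,
    ip_sum_left _ hψ fun e => hY (Submodule.smul_mem _ _
      (Submodule.add_mem _ (raise_mem_rapid _ hψa) (ite_mem_rapid _ hψ)))]
  congr 1
  refine Finset.sum_congr rfl fun e _ => ?_
  -- The number operator moves to the right slot, where `lower (p e)` meets it. Their commutator
  -- survives only for `e = c` and produces the extra column.
  rw [map_smul, map_smul, ip_smul_left, ip_raise_left, ← ip_raise_right,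
    ip_add_left (hY hψ) (raise_mem_rapid _ hψa) (ite_mem_rapid _ hψ), ip_raise_left, lower_raise,
    ip_add_right hψa (raise_mem_rapid _ (lower_mem_rapid _ (lower_mem_rapid _ hψ)))
      (ite_mem_rapid _ (lower_mem_rapid _ hψ)), ip_raise_right, lower_comm (p e)]
  congr 1
  simp only [hp.eq_iff, Matrix.add_apply, weightedGram, gram, Matrix.of_apply, Matrix.smul_apply,
    Matrix.one_apply, smul_eq_mul]
  by_cases hae : a = e
  · subst hae
    by_cases hac : a = c
    · subst hac
      simp [ip_raise_right]
    · simp [hac, ip_zero_right, ip_raise_right]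
  · by_cases hec : e = c
    · subst hec
      simp [hae, ip_zero_left]
    · simp [hae, hec, ip_zero_left, ip_zero_right]

/-- Recursion for the Gram matrix weighted with the occupation number of a mode of the other
family. -/
theorem Paired.weightedGram_eq' (h : Paired p q Z ψ ψ) (hp : Function.Injective p)
    (hq : Function.Injective q) (hpq : ∀ a b, p a ≠ q b) (hψ : ψ ∈ rapid n) (c : Fin n) :
    weightedGram p (q c) ψ =
      (weightedGram p (q c) ψ + gram q ψ c c • 1) * (Zᴴ * Z) +
        Matrix.of fun a b => ip (lower (q c) (lower (p a) ψ)) ψ * Z c b := by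
  ext a b
  have hψa := lower_mem_rapid (p a) hψ
  have hY : ∀ {φ : Formal n}, φ ∈ rapid n → raise (q c) (lower (q c) φ) ∈ rapid n := fun hφ =>
    raise_mem_rapid _ (lower_mem_rapid _ hφ)
  have e1 : weightedGram p (q c) ψ a b =
      ip (raise (q c) (lower (q c) (lower (p a) ψ))) (lower (p b) ψ) := by
    rw [ip_raise_left]; rfl
  have e2 : ∀ d, ip (lower (q d) (raise (q c) (lower (q c) (lower (p a) ψ)))) ψ =
      (∑ e, starRingEnd ℂ (Z d e) * (weightedGram p (q c) ψ + gram q ψ c c • 1) a e) +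
        if d = c then ip (lower (q c) (lower (p a) ψ)) ψ else 0 := by
    intro d
    -- Here `lower (q d)` does not commute with `raise (q c)`; the commutator at `d = c` is the
    -- anomalous term.
    rw [lower_raise, ip_add_left hψ (raise_mem_rapid _ (lower_mem_rapid _ (lower_mem_rapid _ hψa)))
      (ite_mem_rapid _ (lower_mem_rapid _ hψa)), lower_comm (q d), h.lower_lower hp, map_sum,
      map_sum, ip_sum_left _ hψ fun e => hY (Submodule.smul_mem _ _
        (Submodule.add_mem _ (raise_mem_rapid _ hψa) (ite_mem_rapid _ hψ)))]
    congr 1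
    · refine Finset.sum_congr rfl fun e _ => ?_
      rw [map_smul, map_smul, ip_smul_left, ip_raise_left, ← ip_raise_right,
        ip_add_left (hY hψ) (raise_mem_rapid _ hψa) (ite_mem_rapid _ hψ), ip_raise_left,
        lower_raise_of_ne (hpq e c), ip_raise_right, lower_comm (p e)]
      congr 1
      by_cases hae : a = e
      · simp [hae, weightedGram, gram, ip_raise_right]
      · simp [hae, weightedGram, gram, ip_zero_left]
    · simp only [hq.eq_iff]
      split_ifs
      exacts [rfl, ip_zero_left _]
  rw [e1, h.ip_lower hψ (hY hψa), Matrix.add_apply, Matrix.mul_apply, ← sum_mul_sum_conj]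
  simp only [e2, mul_add, Finset.sum_add_distrib]
  simp [mul_comm]

/-- The mean occupation numbers of a normalised vector. -/
theorem Paired.gram_eq_mul_inv (h : Paired p q Z ψ ψ) (hp : Function.Injective p)
    (hψ : ψ ∈ rapid n) (h1 : ip ψ ψ = 1) (hZ : IsUnit (1 - Zᴴ * Z).det) :
    gram p ψ = Zᴴ * Z * (1 - Zᴴ * Z)⁻¹ := by
  have h2 := h.gram_eq hp hψ hψ
  rw [h1, one_smul] at h2
  have h3 : gram p ψ * (1 - Zᴴ * Z) = Zᴴ * Z := by
    rw [mul_sub, mul_one]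
    nth_rw 1 [h2]
    noncomm_ring
  rw [← Matrix.mul_nonsing_inv_cancel_right _ (gram p ψ) hZ, h3]

/-- Wick's rule within one family. The linear equation is solved by inverting `1 - Zᴴ * Z`, and each
of its two source terms then acquires a factor `gram p ψ`. -/
theorem Paired.weightedGram_same (h : Paired p q Z ψ ψ) (hp : Function.Injective p)
    (hpq : ∀ a b, p a ≠ q b) (hψ : ψ ∈ rapid n) (h1 : ip ψ ψ = 1)
    (hZ : IsUnit (1 - Zᴴ * Z).det) (a b c : Fin n) :
    weightedGram p (p c) ψ a b =
      gram p ψ c c * gram p ψ a b + gram p ψ a c * gram p ψ c b := by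
  have h2 := h.weightedGram_eq hp hpq hψ c
  set N : Matrix (Fin n) (Fin n) ℂ := Matrix.of fun a e => if e = c then gram p ψ a c else 0
  have h3 : weightedGram p (p c) ψ * (1 - Zᴴ * Z) = (gram p ψ c c • 1 + N) * (Zᴴ * Z) := by
    rw [mul_sub, mul_one]
    nth_rw 1 [h2]
    noncomm_ring
  have h4 : weightedGram p (p c) ψ = gram p ψ c c • gram p ψ + N * gram p ψ := by
    rw [← Matrix.mul_nonsing_inv_cancel_right _ (weightedGram p (p c) ψ) hZ, h3, Matrix.mul_assoc,
      ← h.gram_eq_mul_inv hp hψ h1 hZ, Matrix.add_mul, Matrix.smul_mul, Matrix.one_mul]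
  rw [h4]
  simp [N, Matrix.mul_apply]

/-- Wick's rule across the families: the exchange term is replaced by a product of anomalous
contractions. -/
theorem Paired.weightedGram_other (h : Paired p q Z ψ ψ) (hp : Function.Injective p)
    (hq : Function.Injective q) (hpq : ∀ a b, p a ≠ q b) (hψ : ψ ∈ rapid n) (h1 : ip ψ ψ = 1)
    (hZ : IsUnit (1 - Zᴴ * Z).det) (a b c : Fin n) :
    weightedGram p (q c) ψ a b = gram q ψ c c * gram p ψ a b +
      ip (lower (q c) (lower (p a) ψ)) ψ * (Z * (1 - Zᴴ * Z)⁻¹) c b := by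
  have h2 := h.weightedGram_eq' hp hq hpq hψ c
  set w : Fin n → ℂ := fun a => ip (lower (q c) (lower (p a) ψ)) ψ
  set N : Matrix (Fin n) (Fin n) ℂ := Matrix.of fun a e => if e = c then w a else 0
  have hN : ∀ Y : Matrix (Fin n) (Fin n) ℂ, N * Y = Matrix.of fun a b => w a * Y c b := by
    intro Y
    ext a b
    simp [N, Matrix.mul_apply]
  change _ = _ + Matrix.of fun a b => w a * Z c b at h2
  rw [← hN] at h2
  have h3 : weightedGram p (q c) ψ * (1 - Zᴴ * Z) = gram q ψ c c • (Zᴴ * Z) + N * Z := by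
    rw [mul_sub, mul_one]
    nth_rw 1 [h2]
    rw [Matrix.add_mul, Matrix.smul_mul, Matrix.one_mul]
    abel
  have h4 : weightedGram p (q c) ψ =
      gram q ψ c c • gram p ψ + N * (Z * (1 - Zᴴ * Z)⁻¹) := by
    rw [← Matrix.mul_nonsing_inv_cancel_right _ (weightedGram p (q c) ψ) hZ, h3, Matrix.add_mul,
      Matrix.smul_mul, ← h.gram_eq_mul_inv hp hψ h1 hZ, Matrix.mul_assoc]
  rw [h4, hN]
  simp [w]

end

/-! ### Pair creation operators -/

/-- The operator creating pairs of quanta with amplitudes `Z`. -/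
def pairCreation (p q : Fin n → Mode n) (Z : Matrix (Fin n) (Fin n) ℂ) :
    Module.End ℂ (Formal n) := ∑ d, ∑ b, Z d b • (raise (q d) * raise (p b))

theorem pairCreation_apply (p q : Fin n → Mode n) (Z : Matrix (Fin n) (Fin n) ℂ) (ψ : Formal n) :
    pairCreation p q Z ψ = ∑ d, ∑ b, Z d b • raise (q d) (raise (p b) ψ) := by
  simp [pairCreation, LinearMap.sum_apply]

theorem pairCreation_swap (p q : Fin n → Mode n) (Z : Matrix (Fin n) (Fin n) ℂ) :
    pairCreation q p Zᵀ = pairCreation p q Z := by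
  ext1 ψ
  rw [pairCreation_apply, pairCreation_apply, Finset.sum_comm]
  refine Finset.sum_congr rfl fun d _ => Finset.sum_congr rfl fun b _ => ?_
  rw [raise_comm, Matrix.transpose_apply]

/-- By antisymmetry of `ζ` the two halves of `F̃_ζ` coincide, which cancels the factor `½`. -/
theorem half_opFtOf {ζ : Matrix (Fin n) (Fin n) ℂ} (hζ : ζᵀ = -ζ) :
    (1 / 2 : ℂ) • opFtOf ζ = pairCreation Sum.inl Sum.inr ζ := by
  have h1 : opFtOf ζ =
      pairCreation Sum.inl Sum.inr ζ - pairCreation Sum.inr Sum.inl ζ := by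
    simp only [opFtOf, pairCreation, opFt, smul_sub, Finset.sum_sub_distrib]
    rfl
  have h2 : pairCreation Sum.inr Sum.inl ζ = - pairCreation Sum.inl Sum.inr ζ := by
    rw [← pairCreation_swap, hζ]
    ext1 ψ
    simp only [LinearMap.neg_apply, pairCreation_apply, Matrix.neg_apply, neg_smul,
      Finset.sum_neg_distrib]
  rw [h1, h2, sub_neg_eq_add, ← two_smul ℂ, smul_smul]
  norm_num

theorem pairCreation_raise (p q : Fin n → Mode n) (Z : Matrix (Fin n) (Fin n) ℂ) (m : Mode n)
    (ψ : Formal n) : pairCreation p q Z (raise m ψ) = raise m (pairCreation p q Z ψ) := by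
  simp only [pairCreation_apply, map_sum, map_smul]
  refine Finset.sum_congr rfl fun d _ => Finset.sum_congr rfl fun b _ => ?_
  rw [raise_comm (p b), raise_comm (q d)]

section

variable {p q : Fin n → Mode n}

theorem lower_pairCreation (hp : Function.Injective p) (hpq : ∀ a b, p a ≠ q b)
    (Z : Matrix (Fin n) (Fin n) ℂ) (b : Fin n) (ψ : Formal n) :
    lower (p b) (pairCreation p q Z ψ) =
      pairCreation p q Z (lower (p b) ψ) + ∑ d, Z d b • raise (q d) ψ := by
  simp only [pairCreation_apply, map_sum, map_smul, ← Finset.sum_add_distrib]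
  refine Finset.sum_congr rfl fun d _ => ?_
  simp only [lower_raise_of_ne (hpq b d), lower_raise (p b) (p _), hp.eq_iff, map_add, smul_add,
    Finset.sum_add_distrib]
  simp [apply_ite]

theorem lower_vac (m : Mode n) : lower m (vac : Formal n) = 0 := by
  funext x
  rw [lower_apply, vac, Pi.single_eq_of_ne, mul_zero, Pi.zero_apply]
  intro h
  have := congrFun h m
  simp at this

/-- The commutator of `lower (p b)` with pair creation is a sum of raising operators, which commute
with pair creation. So lowering differentiates powers, and the vacuum contributes nothing. -/
theorem lower_pairCreation_pow (hp : Function.Injective p) (hpq : ∀ a b, p a ≠ q b)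
    (Z : Matrix (Fin n) (Fin n) ℂ) (b : Fin n) (k : ℕ) :
    lower (p b) ((pairCreation p q Z ^ (k + 1)) vac) =
      ((k : ℂ) + 1) • ∑ d, Z d b • raise (q d) ((pairCreation p q Z ^ k) vac) := by
  induction k with
  | zero => simp [lower_pairCreation hp hpq, lower_vac]
  | succ k ih =>
    rw [pow_succ', Module.End.mul_apply, lower_pairCreation hp hpq, ih, map_smul, map_sum]
    simp only [map_smul, pairCreation_raise]
    simp only [← Module.End.mul_apply, ← pow_succ']
    push_cast
    module

end

/-! ### The terms of the exponential series -/

/-- The term of order `k` of the series of the coherent state. -/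
def level (ζ : Matrix (Fin n) (Fin n) ℂ) (k : ℕ) : Formal n := (expTerm ζ k : Formal n)

theorem level_eq (ζ : Matrix (Fin n) (Fin n) ℂ) (k : ℕ) :
    level ζ k = ((k.factorial : ℂ)⁻¹) • (((1 / 2 : ℂ) • opFtOf ζ) ^ k) vac := rfl

theorem level_zero (ζ : Matrix (Fin n) (Fin n) ℂ) : level ζ 0 = vac := by simp [level_eq]

theorem level_succ (ζ : Matrix (Fin n) (Fin n) ℂ) (k : ℕ) :
    ((k : ℂ) + 1) • level ζ (k + 1) = ((1 / 2 : ℂ) • opFtOf ζ) (level ζ k) := by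
  have h : (k : ℂ) + 1 ≠ 0 := by exact_mod_cast k.succ_ne_zero
  rw [level_eq, level_eq, map_smul, smul_smul, pow_succ', Module.End.mul_apply, Nat.factorial_succ]
  congr 1
  push_cast
  field_simp

theorem half_opFtOf_mem_rapid (ζ : Matrix (Fin n) (Fin n) ℂ) {ψ : Formal n} (h : ψ ∈ rapid n) :
    ((1 / 2 : ℂ) • opFtOf ζ) ψ ∈ rapid n := by
  have : ((1 / 2 : ℂ) • opFtOf ζ) ψ = (1 / 2 : ℂ) • ∑ a, ∑ b, ζ a b •
      (raise (Sum.inr a) (raise (Sum.inl b) ψ) - raise (Sum.inl a) (raise (Sum.inr b) ψ)) := by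
    simp [opFtOf, LinearMap.sum_apply, opFt, opAdag, opBdag]
  rw [this]
  refine Submodule.smul_mem _ _ (Submodule.sum_mem _ fun a _ => Submodule.sum_mem _ fun b _ =>
    Submodule.smul_mem _ _ (Submodule.sub_mem _ ?_ ?_)) <;>
  exact raise_mem_rapid _ (raise_mem_rapid _ h)

theorem vac_mem_rapid : (vac : Formal n) ∈ rapid n := by
  refine mem_rapid_of_finite (memℓp_zero_iff.2 ((Set.finite_singleton (0 : Occ n)).subset ?_))
  intro x hx
  by_contra hne
  exact hx (Pi.single_eq_of_ne hne _)

theorem level_mem_rapid (ζ : Matrix (Fin n) (Fin n) ℂ) (k : ℕ) : level ζ k ∈ rapid n := by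
  induction k with
  | zero => rw [level_zero]; exact vac_mem_rapid
  | succ k ih =>
    have h : (k : ℂ) + 1 ≠ 0 := by exact_mod_cast k.succ_ne_zero
    rw [← Submodule.smul_mem_iff _ h, level_succ]
    exact half_opFtOf_mem_rapid ζ ih

theorem level_paired_aux {ζ : Matrix (Fin n) (Fin n) ℂ} {p q : Fin n → Mode n}
    {Z : Matrix (Fin n) (Fin n) ℂ} (hp : Function.Injective p) (hpq : ∀ a b, p a ≠ q b)
    (hK : (1 / 2 : ℂ) • opFtOf ζ = pairCreation p q Z) (k : ℕ) (b : Fin n) :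
    lower (p b) (level ζ (k + 1)) = ∑ d, Z d b • raise (q d) (level ζ k) := by
  have h : (k : ℂ) + 1 ≠ 0 := by exact_mod_cast k.succ_ne_zero
  have h' : (k.factorial : ℂ) ≠ 0 := by exact_mod_cast k.factorial_ne_zero
  rw [level_eq, level_eq, hK, map_smul, lower_pairCreation_pow hp hpq, smul_smul]
  simp only [map_smul, Finset.smul_sum]
  refine Finset.sum_congr rfl fun d _ => ?_
  rw [smul_comm (Z d b), Nat.factorial_succ]
  congr 1
  push_cast
  field_simp

/-- The factorials absorb the factor `k + 1` of `lower_pairCreation_pow`. Exchanging the two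
families transposes the amplitudes, so one computation serves both halves. -/
theorem level_paired {ζ : Matrix (Fin n) (Fin n) ℂ} (hζ : ζᵀ = -ζ) (k : ℕ) :
    Paired Sum.inl Sum.inr ζ (level ζ (k + 1)) (level ζ k) :=
  ⟨level_paired_aux Sum.inl_injective (by simp) (half_opFtOf hζ) k,
    level_paired_aux (Z := ζᵀ) Sum.inr_injective (by simp)
      ((half_opFtOf hζ).trans (pairCreation_swap _ _ _).symm) k⟩

theorem lower_level_zero (ζ : Matrix (Fin n) (Fin n) ℂ) (m : Mode n) :
    lower m (level ζ 0) = 0 := by rw [level_zero, lower_vac]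

/-- If `ψ` and `ψ'` are paired, the number operator of a family creates pairs from `ψ'`. -/
theorem Paired.number_eq {p q : Fin n → Mode n} {Z : Matrix (Fin n) (Fin n) ℂ} {ψ ψ' : Formal n}
    (h : Paired p q Z ψ ψ') :
    ∑ b, raise (p b) (lower (p b) ψ) = pairCreation p q Z ψ' := by
  simp only [h.1, map_sum, map_smul, pairCreation_apply]
  rw [Finset.sum_comm]
  refine Finset.sum_congr rfl fun d _ => Finset.sum_congr rfl fun b _ => ?_
  rw [raise_comm]

/-- Pairing turns the number operator at order `k + 1` into pair creation at order `k`, which is the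
recursion of the exponential series. -/
theorem number_inl_level {ζ : Matrix (Fin n) (Fin n) ℂ} (hζ : ζᵀ = -ζ) (k : ℕ) :
    ∑ b : Fin n, raise (Sum.inl b) (lower (Sum.inl b) (level ζ k)) = (k : ℂ) • level ζ k := by
  cases k with
  | zero => simp [lower_level_zero]
  | succ k =>
    rw [(level_paired hζ k).number_eq, ← half_opFtOf hζ, ← level_succ]
    push_cast
    rfl

theorem number_inr_level {ζ : Matrix (Fin n) (Fin n) ℂ} (hζ : ζᵀ = -ζ) (k : ℕ) :
    ∑ b : Fin n, raise (Sum.inr b) (lower (Sum.inr b) (level ζ k)) = (k : ℂ) • level ζ k := by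
  cases k with
  | zero => simp [lower_level_zero]
  | succ k =>
    rw [(level_paired hζ k).swap.number_eq, pairCreation_swap, ← half_opFtOf hζ, ← level_succ]
    push_cast
    rfl

/-- The term of order `k` lives on states with `2k` quanta. -/
theorem occ_of_level_ne_zero {ζ : Matrix (Fin n) (Fin n) ℂ} (hζ : ζᵀ = -ζ) {k : ℕ} {x : Occ n}
    (hx : level ζ k x ≠ 0) : occ x = 2 * k := by
  have h1 := congrFun (number_inl_level hζ k) x
  have h2 := congrFun (number_inr_level hζ k) x
  simp only [Finset.sum_apply, raise_lower_apply, Pi.smul_apply, smul_eq_mul,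
    ← Finset.sum_mul] at h1 h2
  have h1' := mul_right_cancel₀ hx h1
  have h2' := mul_right_cancel₀ hx h2
  norm_cast at h1' h2'
  rw [occ, Fintype.sum_sum_type, h1', h2']
  ring

/-- The squared norm of the term of order `k`. -/
def levelNormSq (ζ : Matrix (Fin n) (Fin n) ℂ) (k : ℕ) : ℝ := ∑' x, ‖level ζ k x‖ ^ 2

theorem levelNormSq_nonneg (ζ : Matrix (Fin n) (Fin n) ℂ) (k : ℕ) : 0 ≤ levelNormSq ζ k :=
  tsum_nonneg fun _ => sq_nonneg _

theorem ip_level (ζ : Matrix (Fin n) (Fin n) ℂ) (k : ℕ) :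
    ip (level ζ k) (level ζ k) = (levelNormSq ζ k : ℂ) := ip_self _

theorem levelNormSq_zero (ζ : Matrix (Fin n) (Fin n) ℂ) : levelNormSq ζ 0 = 1 := by
  rw [levelNormSq, level_zero, tsum_eq_single 0]
  · simp [vac]
  · intro x hx
    simp [vac, hx]

/-- The recursion `Paired.gram_eq` unrolled down to the vacuum, whose Gram matrix vanishes. Its
trace, compared with `trace_gram_level`, gives Newton's identities. -/
theorem gram_level {ζ : Matrix (Fin n) (Fin n) ℂ} (hζ : ζᵀ = -ζ) (k : ℕ) :
    gram Sum.inl (level ζ k) =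
      ∑ j ∈ Finset.range k, (levelNormSq ζ (k - 1 - j) : ℂ) • (ζᴴ * ζ) ^ (j + 1) := by
  induction k with
  | zero =>
    ext a b
    simp [gram, lower_level_zero, ip_zero_left]
  | succ k ih =>
    rw [(level_paired hζ k).gram_eq Sum.inl_injective (level_mem_rapid ζ _) (level_mem_rapid ζ _),
      ip_level, ih, Finset.sum_range_succ', Matrix.add_mul, Finset.sum_mul]
    congr 1
    · refine Finset.sum_congr rfl fun j _ => ?_
      rw [Matrix.smul_mul, pow_succ _ (j + 1), show k + 1 - 1 - (j + 1) = k - 1 - j by omega]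
    · simp

theorem trace_gram_level {ζ : Matrix (Fin n) (Fin n) ℂ} (hζ : ζᵀ = -ζ) (k : ℕ) :
    (gram Sum.inl (level ζ k)).trace = (k : ℂ) * (levelNormSq ζ k : ℂ) := by
  rw [← ip_level, ← ip_smul_right, ← number_inl_level hζ, ip_sum_right _ (level_mem_rapid ζ k)
    fun b => raise_mem_rapid _ (lower_mem_rapid _ (level_mem_rapid ζ k))]
  exact Finset.sum_congr rfl fun b _ => by rw [ip_raise_right]; rfl

/-- Newton's recursion for the squared norms. -/
theorem levelNormSq_recursion {ζ : Matrix (Fin n) (Fin n) ℂ} (hζ : ζᵀ = -ζ) (k : ℕ) :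
    ((k : ℂ) + 1) * (levelNormSq ζ (k + 1) : ℂ) =
      ∑ j ∈ Finset.range (k + 1), (levelNormSq ζ (k - j) : ℂ) * ((ζᴴ * ζ) ^ (j + 1)).trace := by
  have h := trace_gram_level hζ (k + 1)
  rw [gram_level hζ, Matrix.trace_sum] at h
  push_cast at h
  rw [← h]
  exact Finset.sum_congr rfl fun j _ => by simp [Matrix.trace_smul]

/-! ### Complete homogeneous symmetric polynomials -/

section PowerSeries

variable {ι : Type*}

/-- The generating function of the complete homogeneous symmetric polynomials in `μ`. -/
def geomProd (s : Finset ι) (μ : ι → ℝ) : PowerSeries ℝ :=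
  ∏ i ∈ s, PowerSeries.mk fun k => μ i ^ k

theorem geomProd_insert [DecidableEq ι] {s : Finset ι} {i : ι} (hi : i ∉ s) (μ : ι → ℝ) :
    geomProd (insert i s) μ = PowerSeries.mk (fun k => μ i ^ k) * geomProd s μ :=
  Finset.prod_insert hi

/-- The logarithmic derivative of `1 / (1 - xT)` is `x / (1 - xT)`. -/
theorem derivative_geom (x : ℝ) :
    PowerSeries.derivative ℝ (PowerSeries.mk fun k => x ^ k) =
      (PowerSeries.mk fun k => x ^ k) * PowerSeries.mk fun k => x ^ (k + 1) := by
  ext k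
  rw [PowerSeries.coeff_derivative, PowerSeries.coeff_mul]
  simp only [PowerSeries.coeff_mk]
  rw [Finset.sum_congr rfl (g := fun _ => x ^ (k + 1))]
  · simp
    ring
  · intro p hp
    rw [← pow_add, ← add_assoc, Finset.HasAntidiagonal.mem_antidiagonal.1 hp]

theorem derivative_geomProd (s : Finset ι) (μ : ι → ℝ) :
    PowerSeries.derivative ℝ (geomProd s μ) =
      geomProd s μ * ∑ i ∈ s, PowerSeries.mk fun k => μ i ^ (k + 1) := by
  classical
  induction s using Finset.induction_on with
  | empty => simp [geomProd]
  | insert i s hi ih =>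
    rw [geomProd_insert hi, Finset.sum_insert hi, Derivation.leibniz, ih, derivative_geom]
    simp only [smul_eq_mul]
    ring

/-- Newton's identities, read off from the logarithmic derivative of the generating function. -/
theorem geomProd_recursion (s : Finset ι) (μ : ι → ℝ) (k : ℕ) :
    ((k : ℝ) + 1) * PowerSeries.coeff (k + 1) (geomProd s μ) =
      ∑ j ∈ Finset.range (k + 1),
        PowerSeries.coeff (k - j) (geomProd s μ) * ∑ i ∈ s, μ i ^ (j + 1) := by
  have h := congrArg (PowerSeries.coeff k) (derivative_geomProd s μ)
  rw [PowerSeries.coeff_derivative, PowerSeries.coeff_mul, ← Finset.Nat.sum_antidiagonal_swap,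
    Finset.Nat.sum_antidiagonal_eq_sum_range_succ_mk] at h
  rw [mul_comm, h]
  refine Finset.sum_congr rfl fun j _ => ?_
  simp [map_sum]

/-- The weight is submultiplicative: `i + j + 1 ≤ (i + 1)(j + 1)`. This reduces the claim to the
Cauchy product of two absolutely convergent series. -/
theorem summable_pow_mul_cauchy (p : ℕ) {f g : ℕ → ℝ}
    (hf : Summable fun k : ℕ => ((k : ℝ) + 1) ^ p * |f k|)
    (hg : Summable fun k : ℕ => ((k : ℝ) + 1) ^ p * |g k|) :
    Summable fun k : ℕ => ((k : ℝ) + 1) ^ p *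
      |∑ ij ∈ Finset.HasAntidiagonal.antidiagonal k, f ij.1 * g ij.2| := by
  refine Summable.of_nonneg_of_le (fun k => by positivity) (fun k => ?_)
    (summable_norm_sum_mul_antidiagonal_of_summable_norm hf.norm hg.norm)
  refine le_trans ?_ (le_abs_self _)
  refine (mul_le_mul_of_nonneg_left (Finset.abs_sum_le_sum_abs _ _) (by positivity)).trans ?_
  rw [Finset.mul_sum]
  refine Finset.sum_le_sum fun ij hij => ?_
  have h1 : (k : ℝ) = ij.1 + ij.2 := by
    exact_mod_cast (Finset.HasAntidiagonal.mem_antidiagonal.1 hij).symm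
  have h2 : (k : ℝ) + 1 ≤ ((ij.1 : ℝ) + 1) * ((ij.2 : ℝ) + 1) := by
    rw [h1]
    nlinarith [mul_nonneg (ij.1.cast_nonneg (α := ℝ)) (ij.2.cast_nonneg (α := ℝ))]
  calc _ ≤ (((ij.1 : ℝ) + 1) * ((ij.2 : ℝ) + 1)) ^ p * |f ij.1 * g ij.2| := by gcongr
    _ = _ := by
      rw [mul_pow, abs_mul]
      ring

theorem summable_pow_mul_geom (p : ℕ) {x : ℝ} (h0 : 0 ≤ x) (h1 : x < 1) :
    Summable fun k : ℕ => ((k : ℝ) + 1) ^ p * |x ^ k| := by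
  have hx : ‖x‖ < 1 := by rwa [Real.norm_of_nonneg h0]
  -- The second summand covers `k = 0`, where `k ^ p` may vanish; for `k ≥ 1` one has `k + 1 ≤ 2k`.
  have h2 : Summable fun k : ℕ => (2 : ℝ) ^ p * ((k : ℝ) ^ p * x ^ k) + x ^ k :=
    ((summable_pow_mul_geometric_of_norm_lt_one p hx).mul_left _).add
      (summable_geometric_of_lt_one h0 h1)
  refine Summable.of_nonneg_of_le (fun k => by positivity) (fun k => ?_) h2
  rw [abs_of_nonneg (pow_nonneg h0 k)]
  rcases Nat.eq_zero_or_pos k with rfl | hk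
  · simp
  · have hk' : (1 : ℝ) ≤ k := by exact_mod_cast hk
    have h3 : ((k : ℝ) + 1) ^ p ≤ 2 ^ p * (k : ℝ) ^ p := by
      rw [← mul_pow]
      gcongr
      linarith
    have h4 := mul_le_mul_of_nonneg_right h3 (pow_nonneg h0 k)
    have h5 := pow_nonneg h0 k
    nlinarith

theorem summable_pow_mul_geomProd (p : ℕ) (s : Finset ι) {μ : ι → ℝ} (h0 : ∀ i, 0 ≤ μ i)
    (h1 : ∀ i, μ i < 1) :
    Summable fun k : ℕ => ((k : ℝ) + 1) ^ p * |PowerSeries.coeff k (geomProd s μ)| := by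
  classical
  induction s using Finset.induction_on with
  | empty =>
    refine summable_of_ne_finset_zero (s := {0}) fun k hk => ?_
    have : k ≠ 0 := by simpa using hk
    simp [geomProd, PowerSeries.coeff_one, this]
  | insert i s hi ih =>
    simp only [geomProd_insert hi, PowerSeries.coeff_mul, PowerSeries.coeff_mk]
    exact summable_pow_mul_cauchy p (f := fun k => μ i ^ k)
      (g := fun k => PowerSeries.coeff k (geomProd s μ)) (summable_pow_mul_geom p (h0 i) (h1 i)) ih

theorem tsum_geomProd (s : Finset ι) {μ : ι → ℝ} (h0 : ∀ i, 0 ≤ μ i) (h1 : ∀ i, μ i < 1) :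
    ∑' k, PowerSeries.coeff k (geomProd s μ) = ∏ i ∈ s, (1 - μ i)⁻¹ := by
  classical
  induction s using Finset.induction_on with
  | empty =>
    rw [tsum_eq_single 0]
    · simp [geomProd]
    · intro k hk
      simp [geomProd, PowerSeries.coeff_one, hk]
  | insert i s hi ih =>
    have h2 := summable_pow_mul_geom 0 (h0 i) (h1 i)
    have h3 := summable_pow_mul_geomProd 0 s h0 h1
    simp only [pow_zero, one_mul] at h2 h3
    simp only [geomProd_insert hi, PowerSeries.coeff_mul, PowerSeries.coeff_mk]
    rw [← tsum_mul_tsum_eq_tsum_sum_antidiagonal_of_summable_norm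
      (f := fun k => μ i ^ k) (g := fun k => PowerSeries.coeff k (geomProd s μ)) h2 h3, ih,
      tsum_geometric_of_lt_one (h0 i) (h1 i), Finset.prod_insert hi]

end PowerSeries

/-! ### Spectral calculus of `ζ* ζ` -/

/-- Diagonalisation of `ζ* ζ`. -/
theorem exists_diagonalisation (ζ : Matrix (Fin n) (Fin n) ℂ) :
    ∃ φ : Matrix (Fin n) (Fin n) ℂ ≃⋆ₐ[ℂ] Matrix (Fin n) (Fin n) ℂ,
      ζᴴ * ζ = φ (Matrix.diagonal fun i => (eig ζ i : ℂ)) ∧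
        (∀ M, (φ M).trace = M.trace) ∧ ∀ M, (φ M).det = M.det := by
  have h := Matrix.isHermitian_conjTranspose_mul_self ζ
  refine ⟨Unitary.conjStarAlgAut ℂ _ h.eigenvectorUnitary, h.spectral_theorem, fun M => ?_,
    fun M => ?_⟩
  · rw [Unitary.conjStarAlgAut_apply, Matrix.trace_mul_comm, ← mul_assoc]
    simp
  · rw [Unitary.conjStarAlgAut_apply, Matrix.det_mul_comm, ← mul_assoc]
    simp

theorem eig_nonneg (ζ : Matrix (Fin n) (Fin n) ℂ) (i : Fin n) : 0 ≤ eig ζ i :=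
  (Matrix.posSemidef_conjTranspose_mul_self ζ).eigenvalues_nonneg i

theorem eig_lt_one {ζ : Matrix (Fin n) (Fin n) ℂ} (hζ : ζ ∈ Omega n) (i : Fin n) :
    eig ζ i < 1 := by
  have h := Matrix.isHermitian_conjTranspose_mul_self ζ
  have h1 := hζ.2.conjTranspose_mul_mul_same (B := (h.eigenvectorUnitary : Matrix (Fin n) (Fin n) ℂ)) ?_
  · have h2 : (h.eigenvectorUnitary : Matrix (Fin n) (Fin n) ℂ)ᴴ * (1 - ζᴴ * ζ) *
        h.eigenvectorUnitary = Matrix.diagonal fun i => ((1 - eig ζ i : ℝ) : ℂ) := by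
      have h3 := h.conjStarAlgAut_star_eigenvectorUnitary
      rw [Unitary.conjStarAlgAut_star_apply] at h3
      rw [mul_sub, sub_mul, mul_one, ← Matrix.star_eq_conjTranspose, h3, Unitary.coe_star_mul_self]
      ext a b
      by_cases hab : a = b
      · subst hab
        simp [eig]
      · simp [hab]
    rw [h2, Matrix.posDef_diagonal_iff] at h1
    have := h1 i
    rw [Complex.zero_lt_real] at this
    linarith
  · rw [Matrix.mulVec_injective_iff_isUnit]
    exact ⟨Unitary.toUnits h.eigenvectorUnitary, rfl⟩

theorem trace_pow_eq (ζ : Matrix (Fin n) (Fin n) ℂ) (k : ℕ) :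
    ((ζᴴ * ζ) ^ k).trace = ((∑ i, eig ζ i ^ k : ℝ) : ℂ) := by
  obtain ⟨φ, h1, h2, -⟩ := exists_diagonalisation ζ
  rw [h1, ← map_pow, h2, Matrix.diagonal_pow, Matrix.trace_diagonal]
  simp

theorem det_one_sub_eq (ζ : Matrix (Fin n) (Fin n) ℂ) :
    (1 - ζᴴ * ζ).det = ((∏ i, (1 - eig ζ i) : ℝ) : ℂ) := by
  obtain ⟨φ, h1, -, h2⟩ := exists_diagonalisation ζ
  have h3 : 1 - ζᴴ * ζ = φ (Matrix.diagonal fun i => ((1 - eig ζ i : ℝ) : ℂ)) := by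
    rw [h1, ← map_one φ, ← map_sub, ← Matrix.diagonal_one, Matrix.diagonal_sub]
    simp
  rw [h3, h2, Matrix.det_diagonal]
  simp

theorem diagonalisation_resolvent {ζ : Matrix (Fin n) (Fin n) ℂ} (hζ : ζ ∈ Omega n)
    {φ : Matrix (Fin n) (Fin n) ℂ ≃⋆ₐ[ℂ] Matrix (Fin n) (Fin n) ℂ}
    (h1 : ζᴴ * ζ = φ (Matrix.diagonal fun i => (eig ζ i : ℂ))) :
    ζᴴ * ζ * (1 - ζᴴ * ζ)⁻¹ =
      φ (Matrix.diagonal fun i => ((eig ζ i / (1 - eig ζ i) : ℝ) : ℂ)) := by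
  have h3 : (1 - ζᴴ * ζ)⁻¹ = φ (Matrix.diagonal fun i => (((1 - eig ζ i)⁻¹ : ℝ) : ℂ)) := by
    refine Matrix.inv_eq_right_inv ?_
    rw [h1, ← map_one φ, ← map_sub, ← map_mul, ← Matrix.diagonal_one, Matrix.diagonal_sub,
      Matrix.diagonal_mul_diagonal]
    congr 2
    funext i
    have : 1 - eig ζ i ≠ 0 := by linarith [eig_lt_one hζ i]
    rw [← Complex.ofReal_one, ← Complex.ofReal_sub, ← Complex.ofReal_mul, mul_inv_cancel₀ this]
  rw [h3, h1, ← map_mul, Matrix.diagonal_mul_diagonal]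
  simp [div_eq_mul_inv]

theorem trace_resolvent {ζ : Matrix (Fin n) (Fin n) ℂ} (hζ : ζ ∈ Omega n) :
    (ζᴴ * ζ * (1 - ζᴴ * ζ)⁻¹).trace = ((∑ i, eig ζ i / (1 - eig ζ i) : ℝ) : ℂ) := by
  obtain ⟨φ, h1, h2, -⟩ := exists_diagonalisation ζ
  rw [diagonalisation_resolvent hζ h1, h2, Matrix.trace_diagonal]
  simp

/-- For `x = λ / (1 - λ)` one has `x (x + 1) = λ / (1 - λ)²`. -/
theorem trace_resolvent_mul {ζ : Matrix (Fin n) (Fin n) ℂ} (hζ : ζ ∈ Omega n) :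
    ((ζᴴ * ζ * (1 - ζᴴ * ζ)⁻¹) * (ζᴴ * ζ * (1 - ζᴴ * ζ)⁻¹ + 1)).trace =
      ((∑ i, eig ζ i / (1 - eig ζ i) ^ 2 : ℝ) : ℂ) := by
  obtain ⟨φ, h1, h2, -⟩ := exists_diagonalisation ζ
  rw [diagonalisation_resolvent hζ h1, ← map_one φ, ← map_add, ← map_mul, h2,
    ← Matrix.diagonal_one, Matrix.diagonal_add, Matrix.diagonal_mul_diagonal,
    Matrix.trace_diagonal, Complex.ofReal_sum]
  refine Finset.sum_congr rfl fun i _ => ?_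
  have : 1 - eig ζ i ≠ 0 := by linarith [eig_lt_one hζ i]
  rw [← Complex.ofReal_one, ← Complex.ofReal_add, ← Complex.ofReal_mul]
  congr 1
  field_simp
  ring

theorem isUnit_det_one_sub {ζ : Matrix (Fin n) (Fin n) ℂ} (hζ : ζ ∈ Omega n) :
    IsUnit (1 - ζᴴ * ζ).det := (Matrix.isUnit_iff_isUnit_det _).1 hζ.2.isUnit

/-! ### Convergence and normalisation of the coherent state -/

/-- Both sides start at 1 and obey the same Newton recursion, since the traces of powers of `ζᴴ * ζ`
are the power sums of the eigenvalues. -/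
theorem levelNormSq_eq {ζ : Matrix (Fin n) (Fin n) ℂ} (hζ : ζᵀ = -ζ) (k : ℕ) :
    levelNormSq ζ k = PowerSeries.coeff k (geomProd Finset.univ (eig ζ)) := by
  induction k using Nat.strong_induction_on with
  | _ k ih =>
    cases k with
    | zero => simp [levelNormSq_zero, geomProd, map_prod]
    | succ k =>
      have h := levelNormSq_recursion hζ k
      simp only [trace_pow_eq] at h
      have h' : ((k : ℝ) + 1) * levelNormSq ζ (k + 1) =
          ((k : ℝ) + 1) * PowerSeries.coeff (k + 1) (geomProd Finset.univ (eig ζ)) := by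
        rw [geomProd_recursion]
        have h2 : ((k : ℝ) + 1) * levelNormSq ζ (k + 1) =
            ∑ j ∈ Finset.range (k + 1), levelNormSq ζ (k - j) * ∑ i, eig ζ i ^ (j + 1) := by
          exact_mod_cast h
        rw [h2]
        exact Finset.sum_congr rfl fun j _ => by rw [ih (k - j) (by omega)]
      exact mul_left_cancel₀ (by positivity) h'

theorem summable_pow_mul_levelNormSq {ζ : Matrix (Fin n) (Fin n) ℂ} (hζ : ζ ∈ Omega n) (p : ℕ) :
    Summable fun k : ℕ => ((k : ℝ) + 1) ^ p * levelNormSq ζ k := by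
  refine (summable_pow_mul_geomProd p Finset.univ (eig_nonneg ζ) (eig_lt_one hζ)).congr fun k => ?_
  rw [← levelNormSq_eq hζ.1, abs_of_nonneg (levelNormSq_nonneg ζ k)]

theorem tsum_levelNormSq {ζ : Matrix (Fin n) (Fin n) ℂ} (hζ : ζ ∈ Omega n) :
    ∑' k, levelNormSq ζ k = ∏ i, (1 - eig ζ i)⁻¹ := by
  rw [← tsum_geomProd Finset.univ (eig_nonneg ζ) (eig_lt_one hζ)]
  exact tsum_congr fun k => levelNormSq_eq hζ.1 k

theorem inner_self_eq_ofReal (ψ : Fock n) : inner ℂ ψ ψ = ((‖ψ‖ ^ 2 : ℝ) : ℂ) := by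
  rw [inner_self_eq_norm_sq_to_K, Complex.ofReal_pow]
  rfl

theorem norm_expTerm_sq (ζ : Matrix (Fin n) (Fin n) ℂ) (k : ℕ) :
    ‖expTerm ζ k‖ ^ 2 = levelNormSq ζ k := by
  have h : inner ℂ (expTerm ζ k) (expTerm ζ k) = ip (level ζ k) (level ζ k) := inner_eq_ip _ _
  rw [ip_level, inner_self_eq_ofReal] at h
  exact_mod_cast h

theorem summable_pow_mul_norm_expTerm {ζ : Matrix (Fin n) (Fin n) ℂ} (hζ : ζ ∈ Omega n) (p : ℕ) :
    Summable fun k : ℕ => ((2 * k : ℝ) + 1) ^ p * ‖expTerm ζ k‖ := by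
  have h1 := (summable_pow_mul_levelNormSq hζ (2 * p + 2)).mul_left ((2 : ℝ) ^ (2 * p))
  have h2 : Summable fun k : ℕ => (((k : ℝ) + 1) ^ 2)⁻¹ := by
    have := (summable_nat_add_iff 1).2 (Real.summable_nat_pow_inv.2 (one_lt_two))
    refine this.congr fun k => ?_
    push_cast
    rfl
  refine Summable.of_nonneg_of_le (fun k => by positivity) (fun k => ?_) (h1.add h2)
  rw [← norm_expTerm_sq]
  have hk : (0 : ℝ) ≤ k := k.cast_nonneg
  -- The weighted norm is at most `a * b`, and both `a ^ 2` and `b ^ 2` are summable in `k`; hence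
  -- the weight exponent `2 * p + 2` above.
  set a : ℝ := 2 ^ p * ((k : ℝ) + 1) ^ (p + 1) * ‖expTerm ζ k‖ with ha
  set b : ℝ := ((k : ℝ) + 1)⁻¹ with hb
  have h3 : ((2 * k : ℝ) + 1) ^ p * ‖expTerm ζ k‖ ≤ a * b := by
    have h4 : a * b = (2 * ((k : ℝ) + 1)) ^ p * ‖expTerm ζ k‖ := by
      rw [ha, hb, mul_pow, pow_succ]
      field_simp
    rw [h4]
    gcongr
    linarith
  have h5 : 2 ^ (2 * p) * (((k : ℝ) + 1) ^ (2 * p + 2) * ‖expTerm ζ k‖ ^ 2) = a ^ 2 := by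
    rw [ha]
    ring
  have h6 : (((k : ℝ) + 1) ^ 2)⁻¹ = b ^ 2 := by rw [hb, inv_pow]
  rw [h5, h6]
  nlinarith [sq_nonneg (a - b), sq_nonneg a, sq_nonneg b]

theorem summable_pow_smul_expTerm {ζ : Matrix (Fin n) (Fin n) ℂ} (hζ : ζ ∈ Omega n) (p : ℕ) :
    Summable fun k : ℕ => (((2 * k + 1 : ℕ) : ℂ) ^ p) • expTerm ζ k := by
  refine Summable.of_norm ((summable_pow_mul_norm_expTerm hζ p).congr fun k => ?_)
  rw [norm_smul, norm_pow, Complex.norm_natCast]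
  push_cast
  rfl

theorem summable_expTerm {ζ : Matrix (Fin n) (Fin n) ℂ} (hζ : ζ ∈ Omega n) :
    Summable (expTerm ζ) := by
  simpa using summable_pow_smul_expTerm hζ 0

theorem hasSum_coe {f : ℕ → Fock n} {v : Fock n} (h : HasSum f v) :
    HasSum (fun k => (f k : Formal n)) (v : Formal n) :=
  Pi.hasSum.2 fun x => h.mapL (lp.evalCLM ℂ (fun _ : Occ n => ℂ) 2 x)

/-- The coefficients of the coherent state before normalisation. -/
def expVec (ζ : Matrix (Fin n) (Fin n) ℂ) : Formal n := (∑' k, expTerm ζ k : Fock n)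

theorem hasSum_level {ζ : Matrix (Fin n) (Fin n) ℂ} (hζ : ζ ∈ Omega n) :
    HasSum (level ζ) (expVec ζ) := hasSum_coe (summable_expTerm hζ).hasSum

/-- Order `k` lives on occupation number `2k`, so weighting the terms by `(2k + 1) ^ p` multiplies
the coefficients of the sum by `(occ x + 1) ^ p`. The weighted series still converges in the Hilbert
space. -/
theorem expVec_mem_rapid {ζ : Matrix (Fin n) (Fin n) ℂ} (hζ : ζ ∈ Omega n) :
    expVec ζ ∈ rapid n := by
  intro p
  have h1 := hasSum_coe (summable_pow_smul_expTerm hζ p).hasSum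
  set w : Fock n := ∑' k : ℕ, (((2 * k + 1 : ℕ) : ℂ) ^ p) • expTerm ζ k
  have h2 : ∀ x, w x = ((occ x + 1 : ℕ) : ℂ) ^ p * expVec ζ x := by
    intro x
    refine (Pi.hasSum.1 h1 x).unique ?_
    have h3 := (Pi.hasSum.1 (hasSum_level hζ) x).mul_left (((occ x + 1 : ℕ) : ℂ) ^ p)
    refine (congrArg (fun f => HasSum f _) (funext fun k => ?_)).mpr h3
    change _ * level ζ k x = _
    by_cases hx : level ζ k x = 0
    · simp [hx]
    · rw [occ_of_level_ne_zero hζ.1 hx]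
  have h4 := (lp.memℓp w).summable (by simp)
  refine Summable.of_nonneg_of_le (fun x => by positivity) (fun x => ?_) h4
  have h5 : ‖w x‖ ^ (2 : ENNReal).toReal = (((occ x : ℝ) + 1) ^ p) ^ 2 * ‖expVec ζ x‖ ^ 2 := by
    rw [h2, norm_mul, norm_pow, Complex.norm_natCast, ← mul_pow]
    simp
  rw [h5]
  refine mul_le_mul_of_nonneg_right ?_ (by positivity)
  exact le_self_pow₀ (one_le_pow₀ (by linarith [(occ x).cast_nonneg (α := ℝ)])) two_ne_zero

/-- Ladder operators are continuous for coefficientwise convergence, so the pairing of consecutive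
orders can be summed; the shift by one costs nothing because lowering kills order 0. -/
theorem expVec_paired {ζ : Matrix (Fin n) (Fin n) ℂ} (hζ : ζ ∈ Omega n) :
    Paired Sum.inl Sum.inr ζ (expVec ζ) (expVec ζ) := by
  have h := hasSum_level hζ
  have hl : ∀ m : Mode n, HasSum (fun k => lower m (level ζ (k + 1))) (lower m (expVec ζ)) := by
    intro m
    have := (hasSum_nat_add_iff' 1).2 (h.map (lower m) (continuous_lower m))
    simpa [lower_level_zero] using this
  have hr : ∀ m : Mode n, HasSum (fun k => raise m (level ζ k)) (raise m (expVec ζ)) := fun m =>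
    h.map (raise m) (continuous_raise m)
  constructor
  · intro b
    refine (hl _).unique ?_
    simp only [(level_paired hζ.1 _).1]
    exact hasSum_sum fun d _ => (hr _).const_smul _
  · intro b
    refine (hl _).unique ?_
    simp only [(level_paired hζ.1 _).2]
    exact hasSum_sum fun d _ => (hr _).const_smul _

theorem inner_expTerm_of_ne {ζ : Matrix (Fin n) (Fin n) ℂ} (hζ : ζᵀ = -ζ) {j k : ℕ}
    (hjk : j ≠ k) : inner ℂ (expTerm ζ j) (expTerm ζ k) = 0 := by
  rw [inner_eq_ip, ip]
  refine (tsum_congr fun x => ?_).trans tsum_zero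
  change starRingEnd ℂ (level ζ j x) * level ζ k x = 0
  by_cases h1 : level ζ j x = 0
  · simp [h1]
  · by_cases h2 : level ζ k x = 0
    · simp [h2]
    · have h3 := occ_of_level_ne_zero hζ h1
      have h4 := occ_of_level_ne_zero hζ h2
      omega

theorem ip_expVec {ζ : Matrix (Fin n) (Fin n) ℂ} (hζ : ζ ∈ Omega n) :
    ip (expVec ζ) (expVec ζ) = ((∏ i, (1 - eig ζ i)⁻¹ : ℝ) : ℂ) := by
  have h := (summable_expTerm hζ).hasSum
  have h1 : ∀ k, inner ℂ (∑' k, expTerm ζ k) (expTerm ζ k) = (levelNormSq ζ k : ℂ) := by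
    intro k
    have h2 := h.mapL (innerSL ℂ (expTerm ζ k))
    have h3 : inner ℂ (expTerm ζ k) (∑' k, expTerm ζ k) = (levelNormSq ζ k : ℂ) := by
      refine h2.unique ?_
      have := hasSum_single (f := fun j => innerSL ℂ (expTerm ζ k) (expTerm ζ j)) k
        fun j hj => inner_expTerm_of_ne hζ.1 hj.symm
      rwa [innerSL_apply_apply, inner_self_eq_ofReal, norm_expTerm_sq] at this
    rw [← inner_conj_symm, h3, Complex.conj_ofReal]
  have h4 := h.mapL (innerSL ℂ (∑' k, expTerm ζ k))
  simp only [innerSL_apply_apply, h1] at h4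
  rw [inner_eq_ip] at h4
  rw [← tsum_levelNormSq hζ, Complex.ofReal_tsum]
  exact h4.tsum_eq.symm

theorem coe_coherent (ζ : Matrix (Fin n) (Fin n) ℂ) : (coherent ζ : Formal n) =
    (Real.sqrt (1 - ζᴴ * ζ).det.re : ℂ) • expVec ζ := rfl

theorem coherent_mem_rapid {ζ : Matrix (Fin n) (Fin n) ℂ} (hζ : ζ ∈ Omega n) :
    (coherent ζ : Formal n) ∈ rapid n := Submodule.smul_mem _ _ (expVec_mem_rapid hζ)

theorem coherent_paired {ζ : Matrix (Fin n) (Fin n) ℂ} (hζ : ζ ∈ Omega n) :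
    Paired Sum.inl Sum.inr ζ (coherent ζ : Formal n) (coherent ζ) := (expVec_paired hζ).smul _

theorem ip_coherent {ζ : Matrix (Fin n) (Fin n) ℂ} (hζ : ζ ∈ Omega n) :
    ip (coherent ζ : Formal n) (coherent ζ) = 1 := by
  have h : 0 < ∏ i, (1 - eig ζ i) := Finset.prod_pos fun i _ => by linarith [eig_lt_one hζ i]
  rw [coe_coherent, ip_smul_left, ip_smul_right, ip_expVec hζ, Complex.conj_ofReal,
    det_one_sub_eq, Complex.ofReal_re, ← mul_assoc, ← Complex.ofReal_mul,
    Real.mul_self_sqrt h.le, ← Complex.ofReal_mul, Finset.prod_inv_distrib, mul_inv_cancel₀ h.ne',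
    Complex.ofReal_one]

theorem norm_coherent {ζ : Matrix (Fin n) (Fin n) ℂ} (hζ : ζ ∈ Omega n) : ‖coherent ζ‖ = 1 := by
  have h := inner_eq_ip (coherent ζ) (coherent ζ)
  rw [ip_coherent hζ, inner_self_eq_ofReal] at h
  have h1 : ‖coherent ζ‖ ^ 2 = 1 := by exact_mod_cast h
  exact (pow_eq_one_iff_of_nonneg (norm_nonneg _) two_ne_zero).1 h1

/-! ### Means and variances of the area operators -/

/-- The number operator of a mode. -/
def number (m : Mode n) : Module.End ℂ (Formal n) := raise m * lower m

theorem number_apply (m : Mode n) (ψ : Formal n) : number m ψ = raise m (lower m ψ) := rfl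

theorem number_mem_rapid (m : Mode n) {ψ : Formal n} (h : ψ ∈ rapid n) : number m ψ ∈ rapid n :=
  raise_mem_rapid _ (lower_mem_rapid _ h)

theorem areaAB_apply (a b : Fin n) (ψ : Formal n) :
    areaAB a b ψ = (1 / 2 : ℂ) • (raise (Sum.inl a) (lower (Sum.inl b) ψ) +
      raise (Sum.inr a) (lower (Sum.inr b) ψ)) := by
  rw [areaAB, opE, add_sub_cancel_right]
  rfl

theorem area_apply (a : Fin n) (ψ : Formal n) :
    area a ψ = (1 / 2 : ℂ) • (number (Sum.inl a) ψ + number (Sum.inr a) ψ) := areaAB_apply a a ψ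

theorem areaAB_mem_rapid (a b : Fin n) {ψ : Formal n} (h : ψ ∈ rapid n) :
    areaAB a b ψ ∈ rapid n := by
  rw [areaAB_apply]
  exact Submodule.smul_mem _ _ (Submodule.add_mem _ (raise_mem_rapid _ (lower_mem_rapid _ h))
    (raise_mem_rapid _ (lower_mem_rapid _ h)))

theorem area_mem_rapid (a : Fin n) {ψ : Formal n} (h : ψ ∈ rapid n) : area a ψ ∈ rapid n :=
  areaAB_mem_rapid a a h

theorem totalArea_apply (ψ : Formal n) : totalArea ψ = ∑ a, area a ψ := by
  simp [totalArea, LinearMap.sum_apply]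

theorem totalArea_mem_rapid {ψ : Formal n} (h : ψ ∈ rapid n) : totalArea ψ ∈ rapid n := by
  rw [totalArea_apply]
  exact Submodule.sum_mem _ fun a _ => area_mem_rapid a h

theorem mem_domain_of_rapid {T : Module.End ℂ (Formal n)} {ψ : Fock n}
    (h : T (ψ : Formal n) ∈ rapid n) : ψ ∈ (hilbertOp T).domain := memℓp_of_mem_rapid h

theorem expect_eq_ip {T : Module.End ℂ (Formal n)} {ψ : Fock n}
    (h : T (ψ : Formal n) ∈ rapid n) : expect T ψ = ip (ψ : Formal n) (T (ψ : Formal n)) := by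
  rw [expect, dif_pos (mem_domain_of_rapid h), inner_eq_ip]
  rfl

theorem mul_apply_mem_rapid {S T : Module.End ℂ (Formal n)} {ψ : Formal n}
    (h : S (T ψ) ∈ rapid n) : (S * T) ψ ∈ rapid n := by rwa [Module.End.mul_apply]

theorem ip_number_symm (m : Mode n) (φ ψ : Formal n) : ip φ (number m ψ) = ip (number m φ) ψ := by
  rw [number_apply, number_apply, ip_raise_right, ip_raise_left]

theorem ip_area_symm (a : Fin n) {φ ψ : Formal n} (hφ : φ ∈ rapid n) (hψ : ψ ∈ rapid n) :
    ip φ (area a ψ) = ip (area a φ) ψ := by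
  have h : starRingEnd ℂ (1 / 2) = 1 / 2 := by rw [map_div₀, map_one, map_ofNat]
  rw [area_apply, area_apply, ip_smul_right, ip_smul_left, h,
    ip_add_right hφ (number_mem_rapid _ hψ) (number_mem_rapid _ hψ),
    ip_add_left hψ (number_mem_rapid _ hφ) (number_mem_rapid _ hφ), ip_number_symm, ip_number_symm]

theorem ip_totalArea_symm {φ ψ : Formal n} (hφ : φ ∈ rapid n) (hψ : ψ ∈ rapid n) :
    ip φ (totalArea ψ) = ip (totalArea φ) ψ := by
  rw [totalArea_apply, totalArea_apply, ip_sum_right _ hφ fun a => area_mem_rapid a hψ,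
    ip_sum_left _ hψ fun a => area_mem_rapid a hφ]
  exact Finset.sum_congr rfl fun a _ => ip_area_symm a hφ hψ

/-- Normal ordering: the last term is the commutator that appears when both modes agree. -/
theorem ip_number_number (p : Fin n → Mode n) (a : Fin n) (m : Mode n) {ψ : Formal n}
    (hψ : ψ ∈ rapid n) : ip (number (p a) ψ) (number m ψ) =
      weightedGram p m ψ a a + if p a = m then gram p ψ a a else 0 := by
  have h1 := lower_mem_rapid (p a) hψ
  have h2 := lower_mem_rapid m hψ
  rw [number_apply, number_apply, ip_raise_left, lower_raise,
    ip_add_right h1 (raise_mem_rapid _ (lower_mem_rapid _ h2)) (ite_mem_rapid _ h2),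
    ip_raise_right, lower_comm (p a) m]
  congr 1
  split_ifs with h
  · subst h
    rfl
  · exact ip_zero_right _

/-- Transposition turns `1 - Zᴴ * Z` into `1 - Z * Zᴴ`, and the push-through identity `Z (1 - Z*Z)⁻¹
= (1 - ZZ*)⁻¹ Z` brings it back. -/
theorem mul_inv_transpose {Z : Matrix (Fin n) (Fin n) ℂ} (hZ : Z ∈ Omega n) :
    (Z * (1 - Zᴴ * Z)⁻¹)ᵀ = -(Z * (1 - Zᴴ * Z)⁻¹) := by
  have hu := isUnit_det_one_sub hZ
  have h1 : (1 - Zᴴ * Z)ᵀ = 1 - Z * Zᴴ := by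
    have h2 : Zᴴᵀ = -Zᴴ := by
      rw [← Matrix.conjTranspose_neg, ← hZ.1]
      rfl
    rw [Matrix.transpose_sub, Matrix.transpose_mul, hZ.1, h2, Matrix.transpose_one, neg_mul_neg]
  have hu' : IsUnit (1 - Z * Zᴴ).det := by rwa [← h1, Matrix.det_transpose]
  rw [Matrix.transpose_mul, Matrix.transpose_nonsing_inv, h1, hZ.1, Matrix.mul_neg]
  congr 1
  rw [← Matrix.mul_nonsing_inv_cancel_right _ ((1 - Z * Zᴴ)⁻¹ * Z) hu]
  congr 1
  have h3 : Z * (1 - Zᴴ * Z) = (1 - Z * Zᴴ) * Z := by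
    rw [mul_sub, sub_mul, mul_one, one_mul, Matrix.mul_assoc]
  rw [Matrix.mul_assoc, h3, Matrix.nonsing_inv_mul_cancel_left _ _ hu']

theorem mul_inv_diag {Z : Matrix (Fin n) (Fin n) ℂ} (hZ : Z ∈ Omega n) (c : Fin n) :
    (Z * (1 - Zᴴ * Z)⁻¹) c c = 0 := by
  have h := congrFun (congrFun (mul_inv_transpose hZ) c) c
  rw [Matrix.transpose_apply, Matrix.neg_apply] at h
  linear_combination h / 2

theorem transpose_gram {Z : Matrix (Fin n) (Fin n) ℂ} (hZ : Zᵀ = -Z) : Zᵀᴴ * Zᵀ = Zᴴ * Z := by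
  rw [hZ, Matrix.conjTranspose_neg, neg_mul_neg]

/-- The matrix of the expectation values of the `𝒜_ab`. -/
def meanArea (ζ : Matrix (Fin n) (Fin n) ℂ) : Matrix (Fin n) (Fin n) ℂ :=
  ζᴴ * ζ * (1 - ζᴴ * ζ)⁻¹

section

variable {ζ : Matrix (Fin n) (Fin n) ℂ}

theorem gram_inl_coherent (hζ : ζ ∈ Omega n) :
    gram Sum.inl (coherent ζ : Formal n) = meanArea ζ :=
  (coherent_paired hζ).gram_eq_mul_inv Sum.inl_injective (coherent_mem_rapid hζ) (ip_coherent hζ)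
    (isUnit_det_one_sub hζ)

theorem gram_inr_coherent (hζ : ζ ∈ Omega n) :
    gram Sum.inr (coherent ζ : Formal n) = meanArea ζ := by
  rw [(coherent_paired hζ).swap.gram_eq_mul_inv Sum.inr_injective (coherent_mem_rapid hζ)
    (ip_coherent hζ), transpose_gram hζ.1]
  · rfl
  · rw [transpose_gram hζ.1]
    exact isUnit_det_one_sub hζ

theorem expect_areaAB (hζ : ζ ∈ Omega n) (a b : Fin n) :
    expect (areaAB a b) (coherent ζ) = meanArea ζ a b := by
  have h := coherent_mem_rapid hζ
  have hm : ∀ m m', raise m (lower m' (coherent ζ : Formal n)) ∈ rapid n := fun m m' =>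
    raise_mem_rapid _ (lower_mem_rapid _ h)
  rw [expect_eq_ip (areaAB_mem_rapid a b h), areaAB_apply, ip_smul_right,
    ip_add_right h (hm _ _) (hm _ _), ip_raise_right, ip_raise_right]
  change 1 / 2 * (gram Sum.inl (coherent ζ : Formal n) a b +
    gram Sum.inr (coherent ζ : Formal n) a b) = _
  rw [gram_inl_coherent hζ, gram_inr_coherent hζ]
  ring

theorem expect_area (hζ : ζ ∈ Omega n) (a : Fin n) :
    expect (area a) (coherent ζ) = meanArea ζ a a := expect_areaAB hζ a a

theorem expect_totalArea (hζ : ζ ∈ Omega n) :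
    expect totalArea (coherent ζ) = (meanArea ζ).trace := by
  have h := coherent_mem_rapid hζ
  rw [expect_eq_ip (totalArea_mem_rapid h), totalArea_apply,
    ip_sum_right _ h fun a => area_mem_rapid a h]
  refine Finset.sum_congr rfl fun a _ => ?_
  rw [← expect_eq_ip (area_mem_rapid a h), expect_area hζ]
  rfl

theorem ip_number_inl_inl (hζ : ζ ∈ Omega n) (a c : Fin n) :
    ip (number (Sum.inl a) (coherent ζ : Formal n)) (number (Sum.inl c) (coherent ζ : Formal n)) =
      meanArea ζ a a * meanArea ζ c c +
        meanArea ζ a c * (meanArea ζ c a + if a = c then 1 else 0) := by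
  rw [ip_number_number Sum.inl a (Sum.inl c) (coherent_mem_rapid hζ),
    (coherent_paired hζ).weightedGram_same Sum.inl_injective (by simp) (coherent_mem_rapid hζ)
      (ip_coherent hζ) (isUnit_det_one_sub hζ), gram_inl_coherent hζ]
  simp only [Sum.inl.injEq]
  by_cases hac : a = c
  · subst hac
    simp
    ring
  · simp [hac]
    ring

theorem ip_number_inr_inr (hζ : ζ ∈ Omega n) (a : Fin n) :
    ip (number (Sum.inr a) (coherent ζ : Formal n)) (number (Sum.inr a) (coherent ζ : Formal n)) =
      meanArea ζ a a * meanArea ζ a a + meanArea ζ a a * (meanArea ζ a a + 1) := by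
  rw [ip_number_number Sum.inr a (Sum.inr a) (coherent_mem_rapid hζ),
    (coherent_paired hζ).swap.weightedGram_same Sum.inr_injective (by simp)
      (coherent_mem_rapid hζ) (ip_coherent hζ)
      (by rw [transpose_gram hζ.1]; exact isUnit_det_one_sub hζ), gram_inr_coherent hζ, if_pos rfl]
  ring

/-- The anomalous contribution carries a diagonal entry of an antisymmetric matrix and vanishes: the
two occupation numbers of one leg are uncorrelated. -/
theorem ip_number_inl_inr (hζ : ζ ∈ Omega n) (a : Fin n) :
    ip (number (Sum.inl a) (coherent ζ : Formal n)) (number (Sum.inr a) (coherent ζ : Formal n)) =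
      meanArea ζ a a * meanArea ζ a a := by
  rw [ip_number_number Sum.inl a (Sum.inr a) (coherent_mem_rapid hζ),
    (coherent_paired hζ).weightedGram_other Sum.inl_injective Sum.inr_injective (by simp)
      (coherent_mem_rapid hζ) (ip_coherent hζ) (isUnit_det_one_sub hζ), gram_inl_coherent hζ,
    gram_inr_coherent hζ, mul_inv_diag hζ]
  simp

/-- `area a` is half the sum of two uncorrelated occupation numbers, each of mean `g` and variance
`g (g + 1)`; this gives `¼ · 2 · g (g + 1)`. -/
theorem var_area (hζ : ζ ∈ Omega n) (a : Fin n) :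
    var (area a) (coherent ζ) = 1 / 2 * expect (area a) (coherent ζ) *
      (expect (area a) (coherent ζ) + 1) := by
  have h := coherent_mem_rapid hζ
  have hc : starRingEnd ℂ (1 / 2) = 1 / 2 := by rw [map_div₀, map_one, map_ofNat]
  have hn := fun m : Mode n => number_mem_rapid m h
  have h1 : expect (area a * area a) (coherent ζ) = 1 / 2 * (1 / 2 *
      (meanArea ζ a a * meanArea ζ a a + meanArea ζ a a * (meanArea ζ a a + 1) +
        meanArea ζ a a * meanArea ζ a a + (starRingEnd ℂ (meanArea ζ a a * meanArea ζ a a) +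
          (meanArea ζ a a * meanArea ζ a a + meanArea ζ a a * (meanArea ζ a a + 1))))) := by
    rw [expect_eq_ip (mul_apply_mem_rapid (area_mem_rapid a (area_mem_rapid a h))), Module.End.mul_apply,
      ip_area_symm a h (area_mem_rapid a h), area_apply, ip_smul_left, ip_smul_right, hc,
      ip_add_left (Submodule.add_mem _ (hn _) (hn _)) (hn _) (hn _),
      ip_add_right (hn _) (hn _) (hn _), ip_add_right (hn _) (hn _) (hn _),
      ← ip_conj (number (Sum.inl a) (coherent ζ : Formal n)) (number (Sum.inr a) (coherent ζ)),
      ip_number_inl_inl hζ, ip_number_inr_inr hζ, ip_number_inl_inr hζ, if_pos rfl]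
  have h2 : starRingEnd ℂ (meanArea ζ a a) = meanArea ζ a a := by
    rw [← gram_inl_coherent hζ]
    exact ip_conj _ _
  rw [var, cov, h1, map_mul, h2, expect_area hζ]
  ring

/-- On the coherent state the number operators of both families act as the same pair creation
operator. The variance of the total area thus needs no correlations between the families. -/
theorem totalArea_coherent (hζ : ζ ∈ Omega n) :
    totalArea (coherent ζ : Formal n) = ∑ a, number (Sum.inl a) (coherent ζ : Formal n) := by
  have h1 := (coherent_paired hζ).number_eq
  have h2 := (coherent_paired hζ).swap.number_eq
  rw [pairCreation_swap, ← h1] at h2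
  simp only [totalArea_apply, area_apply, ← Finset.smul_sum, Finset.sum_add_distrib, number_apply]
  rw [h2, ← two_smul ℂ, smul_smul]
  norm_num

theorem var_totalArea (hζ : ζ ∈ Omega n) :
    var totalArea (coherent ζ) =
      ∑ a, ∑ b, meanArea ζ a b * (meanArea ζ b a + if a = b then 1 else 0) := by
  have h := coherent_mem_rapid hζ
  have hn := fun a : Fin n => number_mem_rapid (Sum.inl a) h
  have h1 : expect (totalArea * totalArea) (coherent ζ) =
      ∑ a, ∑ b, (meanArea ζ a a * meanArea ζ b b +
        meanArea ζ a b * (meanArea ζ b a + if a = b then 1 else 0)) := by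
    rw [expect_eq_ip (mul_apply_mem_rapid (totalArea_mem_rapid (totalArea_mem_rapid h))), Module.End.mul_apply,
      ip_totalArea_symm h (totalArea_mem_rapid h), totalArea_coherent hζ,
      ip_sum_left _ (Submodule.sum_mem _ fun a _ => hn a) hn]
    refine Finset.sum_congr rfl fun a _ => ?_
    rw [ip_sum_right _ (hn a) hn]
    exact Finset.sum_congr rfl fun b _ => ip_number_inl_inl hζ a b
  rw [var, cov, h1, expect_totalArea hζ]
  simp only [Finset.sum_add_distrib, ← Finset.mul_sum, ← Finset.sum_mul, Matrix.trace,
    Matrix.diag_apply]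
  ring

theorem expect_totalArea_eq_eig (hζ : ζ ∈ Omega n) :
    expect totalArea (coherent ζ) = ((∑ i, eig ζ i / (1 - eig ζ i) : ℝ) : ℂ) :=
  (expect_totalArea hζ).trans (trace_resolvent hζ)

theorem var_totalArea_eq_eig (hζ : ζ ∈ Omega n) :
    var totalArea (coherent ζ) = ((∑ i, eig ζ i / (1 - eig ζ i) ^ 2 : ℝ) : ℂ) := by
  rw [var_totalArea hζ, ← trace_resolvent_mul hζ]
  refine Finset.sum_congr rfl fun a _ => ?_
  rw [Matrix.diag_apply, Matrix.mul_apply]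
  refine Finset.sum_congr rfl fun b _ => ?_
  rw [Matrix.add_apply, Matrix.one_apply]
  simp only [eq_comm, meanArea]

end

theorem eig_ne_zero_of_ne_zero {ζ : Matrix (Fin n) (Fin n) ℂ} (h : ζ ≠ 0) :
    ∃ i, eig ζ i ≠ 0 := by
  by_contra! h0
  apply h
  rw [← Matrix.conjTranspose_mul_self_eq_zero]
  exact (Matrix.isHermitian_conjTranspose_mul_self ζ).eigenvalues_eq_zero_iff.1 (funext h0)

/-! ### Limit of eigenvalues approaching one -/

section Limit

/-- The mean of the total area in terms of the eigenvalues. -/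
def eigMean (e : Fin n → ℝ) : ℝ := ∑ j, e j / (1 - e j)

/-- The variance of the total area in terms of the eigenvalues. -/
def eigVar (e : Fin n → ℝ) : ℝ := ∑ j, e j / (1 - e j) ^ 2

/-- The coefficient of variation of the total area in terms of the eigenvalues. -/
def eigCoeffVar (e : Fin n → ℝ) : ℝ := Real.sqrt (eigVar e) / eigMean e

variable {e : Fin n → ℝ}

theorem eigMean_pos (h0 : ∀ j, 0 ≤ e j) (h1 : ∀ j, e j < 1) (hne : ∃ j, e j ≠ 0) :
    0 < eigMean e := by
  obtain ⟨j, hj⟩ := hne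
  refine Finset.sum_pos' (fun i _ => div_nonneg (h0 i) (by linarith [h1 i]))
    ⟨j, Finset.mem_univ j, div_pos (lt_of_le_of_ne (h0 j) hj.symm) (by linarith [h1 j])⟩

/-- Cauchy–Schwarz, followed by `e j ^ 2 ≤ e j`. -/
theorem eigMean_sq_le (h0 : ∀ j, 0 ≤ e j) (h1 : ∀ j, e j < 1) :
    eigMean e ^ 2 ≤ n * eigVar e := by
  have h := sq_sum_le_card_mul_sum_sq (s := Finset.univ) (f := fun j => e j / (1 - e j))
  rw [Finset.card_univ, Fintype.card_fin] at h
  refine h.trans (mul_le_mul_of_nonneg_left (Finset.sum_le_sum fun j _ => ?_) n.cast_nonneg)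
  rw [div_pow]
  gcongr
  nlinarith [h0 j, h1 j]

/-- The square of a sum of non-negative terms dominates the sum of squares, and `(1 - δ) * e j ≤ e j
^ 2` holds both for `e j = 0` and for `e j` within `δ` of 1. -/
theorem mul_eigVar_le {δ : ℝ} (h0 : ∀ j, 0 ≤ e j) (h1 : ∀ j, e j < 1)
    (hδ : ∀ j, e j ≠ 0 → |e j - 1| < δ) : (1 - δ) * eigVar e ≤ eigMean e ^ 2 := by
  have h : ∑ j, (e j / (1 - e j)) ^ 2 ≤ eigMean e ^ 2 :=
    Finset.sum_sq_le_sq_sum_of_nonneg fun i _ => div_nonneg (h0 i) (by linarith [h1 i])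
  refine le_trans ?_ h
  rw [eigVar, Finset.mul_sum]
  refine Finset.sum_le_sum fun j _ => ?_
  rw [div_pow, ← mul_div_assoc]
  gcongr
  by_cases hj : e j = 0
  · simp [hj]
  · have := (abs_lt.1 (hδ j hj)).1
    nlinarith [h0 j]

theorem le_eigCoeffVar (h0 : ∀ j, 0 ≤ e j) (h1 : ∀ j, e j < 1) (hne : ∃ j, e j ≠ 0) :
    1 / Real.sqrt (n + 1) ≤ eigCoeffVar e := by
  have hm := eigMean_pos h0 h1 hne
  have hv : 0 ≤ eigVar e := Finset.sum_nonneg fun j _ => div_nonneg (h0 j) (sq_nonneg _)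
  rw [eigCoeffVar, div_le_div_iff₀ (Real.sqrt_pos.2 (by positivity)) hm, one_mul,
    ← Real.sqrt_mul hv]
  refine Real.le_sqrt_of_sq_le ((eigMean_sq_le h0 h1).trans ?_)
  nlinarith

theorem eigCoeffVar_le {δ : ℝ} (h0 : ∀ j, 0 ≤ e j) (h1 : ∀ j, e j < 1) (hne : ∃ j, e j ≠ 0)
    (hδ1 : δ < 1) (hδ : ∀ j, e j ≠ 0 → |e j - 1| < δ) :
    eigCoeffVar e ≤ Real.sqrt (1 - δ)⁻¹ := by
  have hm := eigMean_pos h0 h1 hne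
  have hδ2 : 0 < 1 - δ := by linarith
  have hs : Real.sqrt (1 - δ)⁻¹ * eigMean e = Real.sqrt ((1 - δ)⁻¹ * eigMean e ^ 2) := by
    rw [Real.sqrt_mul (inv_nonneg.2 hδ2.le), Real.sqrt_sq hm.le]
  rw [eigCoeffVar, div_le_iff₀ hm, hs]
  refine Real.sqrt_le_sqrt ?_
  rw [inv_mul_eq_div, le_div_iff₀ hδ2, mul_comm]
  exact mul_eigVar_le h0 h1 hδ

theorem le_eigVar {δ : ℝ} (h0 : ∀ j, 0 ≤ e j) (h1 : ∀ j, e j < 1) (hne : ∃ j, e j ≠ 0)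
    (hδ1 : δ ≤ 1 / 2) (hδ : ∀ j, e j ≠ 0 → |e j - 1| < δ) : 1 / (2 * δ) ≤ eigVar e := by
  obtain ⟨j, hj⟩ := hne
  have h2 := (abs_lt.1 (hδ j hj)).1
  have h3 := h1 j
  have h4 : e j / (1 - e j) ^ 2 ≤ eigVar e :=
    Finset.single_le_sum (f := fun j => e j / (1 - e j) ^ 2)
      (fun i _ => div_nonneg (h0 i) (sq_nonneg _)) (Finset.mem_univ j)
  refine le_trans ?_ h4
  have h5 : 0 < 1 - e j := by linarith
  rw [div_le_div_iff₀ (by linarith) (by positivity)]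
  nlinarith

/-- Rescaling by the distance of the largest eigenvalue to `1`. -/
theorem eigCoeffVar_eq_rescaled {t : ℝ} (ht : 0 < t) :
    eigCoeffVar e = Real.sqrt (∑ j, e j * (t / (1 - e j)) * (t / (1 - e j))) /
      ∑ j, e j * (t / (1 - e j)) := by
  have h1 : ∑ j, e j * (t / (1 - e j)) * (t / (1 - e j)) = t ^ 2 * eigVar e := by
    rw [eigVar, Finset.mul_sum]
    refine Finset.sum_congr rfl fun j _ => ?_
    rw [mul_assoc, div_mul_div_comm, ← sq, ← sq]
    ring
  have h2 : ∑ j, e j * (t / (1 - e j)) = t * eigMean e := by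
    rw [eigMean, Finset.mul_sum]
    exact Finset.sum_congr rfl fun j _ => by ring
  rw [h1, h2, Real.sqrt_mul (sq_nonneg t), Real.sqrt_sq ht.le, mul_div_mul_left _ _ ht.ne',
    eigCoeffVar]

section Family

variable {ι : Type*} {l : Filter ι} {e : ι → Fin n → ℝ}

theorem tendsto_eigVar (h0 : ∀ i j, 0 ≤ e i j) (h1 : ∀ i j, e i j < 1) (hne : ∀ i, ∃ j, e i j ≠ 0)
    (hl : ∀ ε : ℝ, 0 < ε → ∀ᶠ i in l, ∀ j, e i j ≠ 0 → |e i j - 1| < ε) :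
    Tendsto (fun i => eigVar (e i)) l atTop := by
  refine tendsto_atTop.2 fun R => ?_
  have hR : 0 < 2 * (|R| + 1) := by positivity
  -- This `δ` makes the bound `1 / (2 * δ)` of `le_eigVar` equal to `|R| + 1`.
  filter_upwards [hl (1 / (2 * (|R| + 1))) (by positivity)] with i hi
  have h := le_eigVar (h0 i) (h1 i) (hne i) (by
    rw [div_le_div_iff₀ hR two_pos]
    linarith [abs_nonneg R]) hi
  have h2 : 1 / (2 * (1 / (2 * (|R| + 1)))) = |R| + 1 := by field_simp
  linarith [le_abs_self R]

theorem eventually_eigCoeffVar_lt (h0 : ∀ i j, 0 ≤ e i j) (h1 : ∀ i j, e i j < 1)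
    (hne : ∀ i, ∃ j, e i j ≠ 0)
    (hl : ∀ ε : ℝ, 0 < ε → ∀ᶠ i in l, ∀ j, e i j ≠ 0 → |e i j - 1| < ε) {b : ℝ} (hb : 1 < b) :
    ∀ᶠ i in l, eigCoeffVar (e i) < b := by
  have hc : ContinuousAt (fun δ : ℝ => Real.sqrt (1 - δ)⁻¹) 0 := by
    refine Real.continuous_sqrt.continuousAt.comp (ContinuousAt.inv₀ (by fun_prop) (by simp))
  have h2 : ∀ᶠ δ in 𝓝[>] (0 : ℝ), Real.sqrt (1 - δ)⁻¹ < b ∧ δ < 1 :=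
    nhdsWithin_le_nhds ((hc.eventually_lt_const (by simpa using hb)).and
      (eventually_lt_nhds one_pos))
  obtain ⟨δ, ⟨h3, h4⟩, h5⟩ := (h2.and self_mem_nhdsWithin).exists
  filter_upwards [hl δ h5] with i hi
  exact (eigCoeffVar_le (h0 i) (h1 i) (hne i) h4 hi).trans_lt h3

theorem tendsto_eigCoeffVar_nhdsSet (h0 : ∀ i j, 0 ≤ e i j) (h1 : ∀ i j, e i j < 1)
    (hne : ∀ i, ∃ j, e i j ≠ 0)
    (hl : ∀ ε : ℝ, 0 < ε → ∀ᶠ i in l, ∀ j, e i j ≠ 0 → |e i j - 1| < ε)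
    (hc : 1 / Real.sqrt (n + 1) ≤ 1) :
    Tendsto (fun i => eigCoeffVar (e i)) l (𝓝ˢ (Set.Icc (1 / Real.sqrt (n + 1)) 1)) := by
  rw [(hasBasis_nhdsSet _).tendsto_right_iff]
  rintro U ⟨hU, hsub⟩
  -- The lower bound holds exactly, so the interval can be left only at its right end.
  obtain ⟨b, hb, hbU⟩ := exists_Ico_subset_of_mem_nhds (hU.mem_nhds (hsub ⟨hc, le_rfl⟩))
    ⟨2, one_lt_two⟩
  filter_upwards [eventually_eigCoeffVar_lt h0 h1 hne hl hb] with i hi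
  rcases le_or_gt (eigCoeffVar (e i)) 1 with h | h
  · exact hsub ⟨le_eigCoeffVar (h0 i) (h1 i) (hne i), h⟩
  · exact hbU ⟨h.le, hi⟩

theorem exists_mapClusterPt_eigCoeffVar [l.NeBot] (h0 : ∀ i j, 0 ≤ e i j)
    (h1 : ∀ i j, e i j < 1) (hne : ∀ i, ∃ j, e i j ≠ 0)
    (hl : ∀ ε : ℝ, 0 < ε → ∀ᶠ i in l, ∀ j, e i j ≠ 0 → |e i j - 1| < ε) :
    ∃ v : ℝ, MapClusterPt v l (fun i => eigCoeffVar (e i)) := by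
  have h : ∀ᶠ i in l, eigCoeffVar (e i) ∈ Set.Icc (1 / Real.sqrt (n + 1)) 2 := by
    filter_upwards [eventually_eigCoeffVar_lt h0 h1 hne hl one_lt_two] with i hi
    exact ⟨le_eigCoeffVar (h0 i) (h1 i) (hne i), hi.le⟩
  obtain ⟨v, -, hv⟩ := isCompact_Icc.exists_mapClusterPt (le_principal_iff.2 h)
  exact ⟨v, hv⟩

theorem mem_Ioc_of_mapClusterPt (h0 : ∀ i j, 0 ≤ e i j)
    (h1 : ∀ i j, e i j < 1) (hne : ∀ i, ∃ j, e i j ≠ 0)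
    (hl : ∀ ε : ℝ, 0 < ε → ∀ᶠ i in l, ∀ j, e i j ≠ 0 → |e i j - 1| < ε) {v : ℝ}
    (hv : MapClusterPt v l (fun i => eigCoeffVar (e i))) : v ∈ Set.Ioc (0 : ℝ) 1 := by
  have h : ∀ b : ℝ, 1 < b → v ∈ Set.Icc (1 / Real.sqrt (n + 1)) b := by
    intro b hb
    refine isClosed_Icc.closure_subset (hv.mem_closure_of_mem _ ?_)
    rw [Filter.mem_map']
    filter_upwards [eventually_eigCoeffVar_lt h0 h1 hne hl hb] with i hi
    exact ⟨le_eigCoeffVar (h0 i) (h1 i) (hne i), hi.le⟩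
  refine ⟨lt_of_lt_of_le (by positivity) (h 2 one_lt_two).1, ?_⟩
  exact le_of_forall_gt_imp_ge_of_dense fun b hb => (h b hb).2

theorem exists_tendsto_eigCoeffVar [l.NeBot] (h1 : ∀ i j, e i j < 1)
    (hne : ∀ i, ∃ j, e i j ≠ 0)
    (hl : ∀ ε : ℝ, 0 < ε → ∀ᶠ i in l, ∀ j, e i j ≠ 0 → |e i j - 1| < ε) {r : Fin n → ℝ}
    (hr : ∀ j, Tendsto (fun i => (1 - ⨆ k, e i k) / (1 - e i j)) l (𝓝 (r j))) :
    ∃ v : ℝ, Tendsto (fun i => eigCoeffVar (e i)) l (𝓝 v) := by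
  have hmax : ∀ i, ∃ j, e i j = ⨆ k, e i k := fun i =>
    haveI : Nonempty (Fin n) := ⟨(hne i).choose⟩
    exists_eq_ciSup_of_finite
  have hs1 : ∀ i, 0 < 1 - ⨆ k, e i k := fun i => by
    obtain ⟨j, hj⟩ := hmax i
    linarith [h1 i j]
  have hle : ∀ i j, e i j ≤ ⨆ k, e i k := fun i j => le_ciSup (Set.finite_range _).bddAbove j
  have hs : Tendsto (fun i => 1 - ⨆ k, e i k) l (𝓝 0) := by
    refine Metric.tendsto_nhds.2 fun ε hε => ?_
    filter_upwards [hl ε hε] with i hi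
    obtain ⟨j, hj⟩ := hne i
    rw [Real.dist_eq, sub_zero, abs_of_pos (hs1 i)]
    linarith [(abs_lt.1 (hi j hj)).1, hle i j]
  -- With `t = 1 - ⨆ k, e i k`, which tends to 0, one has `λ t / (1 - λ) = t / (1 - λ) - t`; the
  -- factor `λ` disappears in the limit, even for vanishing eigenvalues.
  have hy : ∀ j, Tendsto (fun i => e i j * ((1 - ⨆ k, e i k) / (1 - e i j))) l (𝓝 (r j)) := by
    intro j
    have := (hr j).sub hs
    rw [sub_zero] at this
    refine this.congr fun i => ?_
    have : 1 - e i j ≠ 0 := by linarith [h1 i j]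
    field_simp
    ring
  have hsum : Tendsto (fun i => ∑ j, (1 - ⨆ k, e i k) / (1 - e i j)) l (𝓝 (∑ j, r j)) :=
    tendsto_finsetSum _ fun j _ => hr j
  -- The largest eigenvalue has ratio exactly 1, so the limiting denominator cannot vanish.
  have hpos : 1 ≤ ∑ j, r j := by
    refine ge_of_tendsto' hsum fun i => ?_
    obtain ⟨j, hj⟩ := hmax i
    have h2 : (1 - ⨆ k, e i k) / (1 - e i j) = 1 := by
      rw [hj, div_self (hs1 i).ne']
    refine h2.ge.trans ?_
    exact Finset.single_le_sum (f := fun j => (1 - ⨆ k, e i k) / (1 - e i j))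
      (fun k _ => div_nonneg (hs1 i).le (by linarith [h1 i k])) (Finset.mem_univ j)
  refine ⟨Real.sqrt (∑ j, r j * r j) / ∑ j, r j, ?_⟩
  simp only [fun i => eigCoeffVar_eq_rescaled (e := e i) (hs1 i)]
  refine Tendsto.div ?_ (tendsto_finsetSum _ fun j _ => hy j) (by linarith)
  exact (tendsto_finsetSum _ fun j _ => (hy j).mul (hr j)).sqrt

end Family

end Limit

end CoherentIntertwiner

end

open CoherentIntertwiner in
theorem mainTheorem11 (n : ℕ) :
    (∀ ζ ∈ Omega n,
      -- the state is well defined and normalised, and lies in the domains of all the operators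
      (Summable (expTerm ζ) ∧ ‖coherent ζ‖ = 1) ∧
      (∀ a b : Fin n, coherent ζ ∈ (hilbertOp (areaAB a b)).domain) ∧
      (∀ a b : Fin n, coherent ζ ∈ (hilbertOp (area a * area b)).domain) ∧
      coherent ζ ∈ (hilbertOp (totalArea (n := n))).domain ∧
      coherent ζ ∈ (hilbertOp (totalArea (n := n) * totalArea)).domain ∧
      -- expectation values
      (∀ a : Fin n, expect (area a) (coherent ζ) = (ζᴴ * ζ * (1 - ζᴴ * ζ)⁻¹) a a) ∧
      expect totalArea (coherent ζ) = (ζᴴ * ζ * (1 - ζᴴ * ζ)⁻¹).trace ∧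
      -- variances
      (∀ a : Fin n, var (area a) (coherent ζ) =
        1 / 2 * expect (area a) (coherent ζ) * (expect (area a) (coherent ζ) + 1)) ∧
      var totalArea (coherent ζ) =
        ∑ a : Fin n, ∑ b : Fin n, expect (areaAB a b) (coherent ζ) *
          (expect (areaAB b a) (coherent ζ) + if a = b then 1 else 0)) ∧
    -- the limit in which the non-zero eigenvalues approach one
    (∃ c : ℝ, 0 < c ∧ c ≤ 1 ∧
      ∀ (ι : Type*) (l : Filter ι) [l.NeBot] (Z : ι → Matrix (Fin n) (Fin n) ℂ),
        (∀ i, Z i ∈ Omega n) → (∀ i, Z i ≠ 0) → NonzeroEigTendToOne l Z →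
        -- the variance grows without bound
        Tendsto (fun i => (var totalArea (coherent (Z i))).re) l atTop ∧
        -- the coefficient of variation approaches `[c, 1]`; it has limit points, all in `(0, 1]`
        Tendsto (fun i => coeffVar totalArea (coherent (Z i))) l (𝓝ˢ (Set.Icc c 1)) ∧
        (∃ v : ℝ, MapClusterPt v l (fun i => coeffVar totalArea (coherent (Z i)))) ∧
        (∀ v : ℝ, MapClusterPt v l (fun i => coeffVar totalArea (coherent (Z i))) →
          v ∈ Set.Ioc (0 : ℝ) 1) ∧
        -- it converges whenever the relative rates of approach do
        (∀ r : Fin n → ℝ,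
          (∀ j, Tendsto (fun i => (1 - ⨆ k, eig (Z i) k) / (1 - eig (Z i) j)) l (𝓝 (r j))) →
          ∃ v ∈ Set.Ioc (0 : ℝ) 1,
            Tendsto (fun i => coeffVar totalArea (coherent (Z i))) l (𝓝 v))) := by
  constructor
  · intro ζ hζ
    have h := coherent_mem_rapid hζ
    refine ⟨⟨summable_expTerm hζ, norm_coherent hζ⟩,
      fun a b => mem_domain_of_rapid (areaAB_mem_rapid a b h),
      fun a b => mem_domain_of_rapid (mul_apply_mem_rapid (area_mem_rapid a (area_mem_rapid b h))),
      mem_domain_of_rapid (totalArea_mem_rapid h),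
      mem_domain_of_rapid (mul_apply_mem_rapid (totalArea_mem_rapid (totalArea_mem_rapid h))),
      expect_area hζ, expect_totalArea hζ, var_area hζ, ?_⟩
    simp only [expect_areaAB hζ]
    exact var_totalArea hζ
  · have hc : 1 / Real.sqrt (n + 1) ≤ 1 :=
      div_le_one_of_le₀ (Real.one_le_sqrt.2 (by linarith [n.cast_nonneg (α := ℝ)]))
        (Real.sqrt_nonneg _)
    -- Cauchy–Schwarz would give `1 / √n`; `n + 1` keeps the constant positive at `n = 0`, where
    -- division by zero would return 0.
    refine ⟨1 / Real.sqrt (n + 1), by positivity, hc, ?_⟩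
    intro ι l _ Z hZ hne hl
    have h0 := fun i => eig_nonneg (Z i)
    have h1 := fun i => eig_lt_one (hZ i)
    have hne' := fun i => eig_ne_zero_of_ne_zero (hne i)
    have hvar : ∀ i, (var totalArea (coherent (Z i))).re = eigVar (eig (Z i)) := fun i => by
      rw [var_totalArea_eq_eig (hZ i), Complex.ofReal_re, eigVar]
    have hcv : ∀ i, coeffVar totalArea (coherent (Z i)) = eigCoeffVar (eig (Z i)) := fun i => by
      rw [coeffVar, hvar, expect_totalArea_eq_eig (hZ i), Complex.ofReal_re, eigCoeffVar, eigMean]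
    simp only [hvar, hcv]
    refine ⟨tendsto_eigVar h0 h1 hne' hl, tendsto_eigCoeffVar_nhdsSet h0 h1 hne' hl hc,
      exists_mapClusterPt_eigCoeffVar h0 h1 hne' hl,
      fun v hv => mem_Ioc_of_mapClusterPt h0 h1 hne' hl hv, fun r hr => ?_⟩
    obtain ⟨v, hv⟩ := exists_tendsto_eigCoeffVar h1 hne' hl hr
    exact ⟨v, mem_Ioc_of_mapClusterPt h0 h1 hne' hl hv.mapClusterPt, hv⟩
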